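/- Let $Z=(Z,d,\mu)$ be a metric space with a Borel regular measure $\mu$ for which every ball $B(\xi,r)=\{\eta: d(\xi,\eta)<r\}$, $r>0$, has positive and finite measure, and suppose that $\mu$ is doubling; fix constants $K\ge 1$, $Q>0$ such that $\mu(B(\xi,\lambda r))\le K\lambda^Q\mu(B(\xi,r))$ for all $\xi\in Z$, $r>0$, $\lambda\ge1$. **Hyperbolic filling.** For each $n\in\mathbb Z$ let $(\xi_x)_{x\in X_n}$ be a maximal set of points of $Z$ with pairwise distances at least $2^{-n-1}$. Put $X=\bigsqcup_{n} X_n$, $|x|=n$ and $B(x)=B(\xi_x,2^{-n})$ for $x\in X_n$, and write $x\sim x'$ if $x\ne x'$, $B(x)\cap B(x')\neq\emptyset$ and $\big||x|-|x'|\big|\le1$. For $u\colon X\to\mathbb C$ put $|du(x)|=\big(\sum_{x'\sim x}|u(x')-u(x)|^2\big)^{1/2}$. For $f\in L^1_{\rm loc}(Z)$ (measurable, complex-valued and integrable on bounded sets) put $Pf(x)=\frac1{\mu(B(x))}\int_{B(x)}f\,d\mu$. **The space $\dot{\mathcal B}^s_{p,q}(Z)$** consists of all $f\in L^1_{\rm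 loc}(Z)$ with $$\|f\|_{\dot{\mathcal B}^s_{p,q}(Z)}:=\Big(\sum_{k\in\mathbb Z}2^{ksq}\Big\|\sum_{x\in X_k}|d(Pf)(x)|\,\chi_{B(x)}\Big\|_{L^p(Z)}^q\Big)^{1/q}<\infty$$ (supremum over $k$ if $q=\infty$). **The space $\dot N^s_{p,q}(Z)$.** A fractional $s$-Hajłasz gradient of a measurable $f\colon Z\to\mathbb C$ is a sequence $\vec g=(g_k)_{k\in\mathbb Z}$ of measurable functions $g_k\colon Z\to[0,\infty]$ such that $|f(\xi)-f(\eta)|\le d(\xi,\eta)^s(g_k(\xi)+g_k(\eta))$ for all $k\in\mathbb Z$ and all $\xi,\eta\in Z$ with $2^{-k-1}\le d(\xi,\eta)<2^{-k}$. The space $\dot N^s_{p,q}(Z)$ consists of all measurable $f\colon Z\to\mathbb C$ with $$\|f\|_{\dot N^s_{p,q}(Z)}:=\inf_{\vec g}\big\|\big(\|g_k\|_{L^p(Z)}\big)_{k\in\mathbb Z}\big\|_{\ell^q}<\infty,$$ the infimum being over all fractional $s$-Hajłasz gradients $\vec g$ of $f$. **Proposition.** Let $0<s\le1$, $Q/(Q+s)<p\le\infty$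 and $0<q\le\infty$. Then $$\dot{\mathcal B}^s_{p,q}(Z)=\dot N^s_{p,q}(Z)$$ with equivalent quasi-norms: the two spaces consist of the same functions, and there is a finite constant $C$, independent of $f$ and of the choice of the hyperbolic filling $X$, such that $\|f\|_{\dot N^s_{p,q}(Z)}\le C\|f\|_{\dot{\mathcal B}^s_{p,q}(Z)}$ and $\|f\|_{\dot{\mathcal B}^s_{p,q}(Z)}\le C\|f\|_{\dot N^s_{p,q}(Z)}$ for all such $f$. (In particular the two quasi-norms vanish on the same functions, so that the quotients of the two spaces by these functions coincide as well.) -/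

import Mathlib

open MeasureTheory Metric
open scoped ENNReal NNReal

noncomputable section

/-- The quasi-norm of `ℓ^q(ℤ)`, `0 < q ≤ ∞`, of a sequence of moduli. -/
def lqNorm (q : ℝ≥0∞) (a : ℤ → ℝ≥0∞) : ℝ≥0∞ :=
  if q = ∞ then ⨆ k, a k else (∑' k, a k ^ q.toReal) ^ (1 / q.toReal)

/-- The choices made in the construction of a hyperbolic filling of `Z`: for every level `n`, a
maximal set of points of `Z` with pairwise distances at least `2^{-n-1}`. -/
structure HyperbolicFilling (Z : Type*) [MetricSpace Z] where
  net : ℤ → Set Z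
  maximal_net : ∀ n : ℤ,
    Maximal (fun A : Set Z => A.Pairwise fun a b => (2 : ℝ) ^ (-n - 1) ≤ dist a b) (net n)

namespace HyperbolicFilling

variable {Z : Type*} [MetricSpace Z]

/-- The vertex set `X = ⊔ₙ Xₙ`. -/
abbrev Vertex (X : HyperbolicFilling Z) : Type _ := Σ n : ℤ, X.net n

/-- The level `|x|` of a vertex. -/
def level (X : HyperbolicFilling Z) (x : X.Vertex) : ℤ := x.1

/-- The point `ξ_x` of `Z` attached to a vertex. -/
def center (X : HyperbolicFilling Z) (x : X.Vertex) : Z := x.2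

/-- The ball `B(x) = B(ξ_x, 2^{-|x|})`. -/
def vball (X : HyperbolicFilling Z) (x : X.Vertex) : Set Z :=
  ball (X.center x) ((2 : ℝ) ^ (-X.level x))

/-- The graph `(X, E)`: distinct vertices are joined if and only if their balls intersect and their
levels differ by at most one. -/
def graph (X : HyperbolicFilling Z) : SimpleGraph X.Vertex where
  Adj x y := x ≠ y ∧ (X.vball x ∩ X.vball y).Nonempty ∧ |X.level x - X.level y| ≤ 1
  symm := ⟨fun x y h => ⟨h.1.symm, by rw [Set.inter_comm]; exact h.2.1, by rw [abs_sub_comm]; exact h.2.2⟩⟩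
  loopless := ⟨fun _ h => h.1 rfl⟩

/-- The length `|du(x)| = (∑_{y ∼ x} |u(y) - u(x)|²)^{1/2}` of the discrete derivative of `u`. -/
def derivLength (X : HyperbolicFilling Z) (u : X.Vertex → ℂ) (x : X.Vertex) : ℝ≥0∞ :=
  (∑' y : X.graph.neighborSet x, ‖u y - u x‖ₑ ^ 2) ^ (1 / 2 : ℝ)

variable [MeasurableSpace Z]

/-- The Poisson extension `Pf(x) = ⨍_{B(x)} f dμ`. -/
def poisson (X : HyperbolicFilling Z) (μ : Measure Z) (f : Z → ℂ) (x : X.Vertex) : ℂ :=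
  ⨍ ξ in X.vball x, f ξ ∂μ

/-- The quasi-norm of the sequence space `I^s_{p,q}(X)`, as a functional of the sequence of moduli
`w x = |u(x)|`: the `ℓ^q`-norm over `k` of `2^{ks} ‖∑_{x ∈ X_k} |u(x)| χ_{B(x)}‖_{L^p(Z)}`. -/
def seqNorm (X : HyperbolicFilling Z) (μ : Measure Z) (s : ℝ) (p q : ℝ≥0∞)
    (w : X.Vertex → ℝ≥0∞) : ℝ≥0∞ :=
  lqNorm q fun k : ℤ => (2 : ℝ≥0∞) ^ ((k : ℝ) * s) *
    eLpNorm (fun ξ : Z => ∑' x : X.net k, (X.vball ⟨k, x⟩).indicator (fun _ => w ⟨k, x⟩) ξ) p μ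

/-- The Besov quasi-norm `‖f‖ = ‖ |d(Pf)| ‖` in `I^s_{p,q}(X)`. -/
def besovNorm (X : HyperbolicFilling Z) (μ : Measure Z) (s : ℝ) (p q : ℝ≥0∞) (f : Z → ℂ) : ℝ≥0∞ :=
  X.seqNorm μ s p q (X.derivLength (X.poisson μ f))

end HyperbolicFilling

section

variable {Z : Type*} [MetricSpace Z] [MeasurableSpace Z]

/-- `L^1_loc(Z)`: measurable functions that are integrable on all bounded subsets of `Z`. -/
def IsLocL1 (μ : Measure Z) (f : Z → ℂ) : Prop :=
  AEStronglyMeasurable f μ ∧ ∀ A : Set Z, Bornology.IsBounded A → IntegrableOn f A μ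

/-- The Besov space `B^s_{p,q}(Z)`, as a set of functions, built on the hyperbolic filling `X`. -/
def besovSpace (X : HyperbolicFilling Z) (μ : Measure Z) (s : ℝ) (p q : ℝ≥0∞) : Set (Z → ℂ) :=
  {f | IsLocL1 μ f ∧ X.besovNorm μ s p q f < ∞}

/-- `g = (g_k)` is a fractional `s`-Hajłasz gradient of `f`. -/
def IsHajlaszGradient (μ : Measure Z) (s : ℝ) (f : Z → ℂ) (g : ℤ → Z → ℝ≥0∞) : Prop :=
  (∀ k, AEMeasurable (g k) μ) ∧
    ∀ (k : ℤ) (ξ η : Z), (2 : ℝ) ^ (-k - 1) ≤ dist ξ η → dist ξ η < (2 : ℝ) ^ (-k) →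
      ‖f ξ - f η‖ₑ ≤ ENNReal.ofReal (dist ξ η ^ s) * (g k ξ + g k η)

/-- The quasi-norm of `N^s_{p,q}(Z)`: the infimum, over all fractional `s`-Hajłasz gradients `g` of
`f`, of the `ℓ^q`-norm over `k` of `‖g_k‖_{L^p(Z)}`. -/
def hajlaszNorm (μ : Measure Z) (s : ℝ) (p q : ℝ≥0∞) (f : Z → ℂ) : ℝ≥0∞ :=
  ⨅ (g : ℤ → Z → ℝ≥0∞) (_ : IsHajlaszGradient μ s f g), lqNorm q fun k => eLpNorm (g k) p μ

/-- The space `N^s_{p,q}(Z)`, as a set of (measurable) functions. -/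
def hajlaszSpace (μ : Measure Z) (s : ℝ) (p q : ℝ≥0∞) : Set (Z → ℂ) :=
  {f | AEStronglyMeasurable f μ ∧ hajlaszNorm μ s p q f < ∞}

end

end

/-! Both inequalities come from telescoping along chains of vertices whose balls shrink to a point.
Since `p` and `q` may lie below 1, the triangle inequality is replaced throughout by geometric
weights: `exists_eLpNorm_geom_tsum_le` takes sums with geometric weights out of `L^p`, and the
discrete Hardy inequality `exists_lqNorm_geom_tsum_le` does the same for `ℓ^q`.

From the filling to a gradient: by Lebesgue differentiation, `Pf` along such a chain tends to `f(ξ)`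
for almost every `ξ`. Hence `|Pf(x) - f(ξ)|` is at most the sum over `n ≥ |x|` of the level sums of
`|d(Pf)|` at `ξ`. Two points at distance less than `2^{-k}` lie in a common ball of level `k - 1`,
so these sums, multiplied by `2^{(k+1)s}`, form a Hajłasz gradient (`isHajlaszGradient_levelSum`).
Relative to `2^{ns}`, the weight carries a factor `2^{-sj}` at level `n = k - 1 + j`, and the Hardy
inequality applies.

From a gradient to the filling: here `f` is not known to be locally integrable. The oscillation of
`f` at scale `2^{-k}` is controlled by the tail `h_k` of the gradient. In each ball `B(x)` pick a
point `ζ_x` at which `h` does not exceed its `r`-mean, `r = min(p, 1)`, and telescope the values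
`f(ζ_x)` instead of averages. Integrating the result over `B(x)` costs `2^{jQ(1/r-1)}` at level `|x|
+ j` (`exists_setLIntegral_sub_le`), while `h_{k+j}` gains `2^{-js}`. The condition `p > Q/(Q+s)`
says precisely that the gain wins. This yields local integrability and a bound of `|d(Pf)(x)|` by
geometrically weighted `r`-means of the `g_n` over `16B(x)`. These are at most `p`-means, and finite
overlap makes the resulting averaging operators bounded on `L^p`
(`exists_eLpNorm_levelSum_powerMean_le`). -/

noncomputable section

/-! ### Geometric sums in `ℓ^q` and `L^p` for all positive exponents -/

section Discrete

theorem le_ennreal_rpow_one_div_iff {x y : ℝ≥0∞} {t : ℝ} (ht : 0 < t) :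
    x ≤ y ^ (1 / t) ↔ x ^ t ≤ y := by
  rw [one_div, ENNReal.le_rpow_inv_iff ht]

/-- Sums against weights, raised to a power: `(∑ wᵢ bᵢ)^t ≤ (∑ wᵢ)^t ∑ bᵢ^t`. -/
theorem rpow_tsum_mul_le {ι : Type*} (w b : ι → ℝ≥0∞) {t : ℝ} (ht : 0 < t) :
    (∑' i, w i * b i) ^ t ≤ (∑' i, w i) ^ t * ∑' i, b i ^ t := by
  have h1 : ∀ i, b i ≤ (∑' i, b i ^ t) ^ (1 / t) := fun i => by
    rw [le_ennreal_rpow_one_div_iff ht]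
    exact ENNReal.le_tsum i
  have h2 : ∑' i, w i * b i ≤ (∑' i, w i) * (∑' i, b i ^ t) ^ (1 / t) := by
    rw [← ENNReal.tsum_mul_right]
    exact ENNReal.tsum_le_tsum fun i => by gcongr; exact h1 i
  calc (∑' i, w i * b i) ^ t ≤ ((∑' i, w i) * (∑' i, b i ^ t) ^ (1 / t)) ^ t := by gcongr
    _ = _ := by
      rw [ENNReal.mul_rpow_of_nonneg _ _ ht.le, ← ENNReal.rpow_mul, one_div_mul_cancel ht.ne',
        ENNReal.rpow_one]

theorem tsum_rpow_le_rpow_tsum {ι : Type*} (a : ι → ℝ≥0∞) {r : ℝ} (hr : 1 ≤ r) :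
    ∑' i, a i ^ r ≤ (∑' i, a i) ^ r := by
  have h : ∀ x : ℝ≥0∞, x ^ r = x * x ^ (r - 1) := fun x => by
    conv_lhs => rw [show r = 1 + (r - 1) by ring,
      ENNReal.rpow_add_of_nonneg _ _ zero_le_one (by linarith), ENNReal.rpow_one]
  rw [h (∑' i, a i), ← ENNReal.tsum_mul_right]
  refine ENNReal.tsum_le_tsum fun i => ?_
  rw [h]
  exact mul_le_mul_right (ENNReal.rpow_le_rpow (ENNReal.le_tsum i) (by linarith)) _

theorem two_rpow_add (x y : ℝ) : (2 : ℝ≥0∞) ^ (x + y) = 2 ^ x * 2 ^ y :=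
  ENNReal.rpow_add _ _ two_ne_zero ENNReal.ofNat_ne_top

theorem two_rpow_ne_top (x : ℝ) : (2 : ℝ≥0∞) ^ x ≠ ∞ :=
  ENNReal.rpow_ne_top_of_ne_zero two_ne_zero ENNReal.ofNat_ne_top

theorem two_rpow_ne_zero (x : ℝ) : (2 : ℝ≥0∞) ^ x ≠ 0 := by
  simp [ENNReal.rpow_eq_zero_iff]

theorem two_rpow_mono {x y : ℝ} (h : x ≤ y) : (2 : ℝ≥0∞) ^ x ≤ 2 ^ y :=
  ENNReal.rpow_le_rpow_of_exponent_le one_le_two h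

/-- The sum `∑_{j ≥ 0} 2^{-jε}`. -/
def geomSum (ε : ℝ) : ℝ≥0∞ := ∑' j : ℕ, (2 : ℝ≥0∞) ^ (-(ε * j))

theorem geomSum_ne_top {ε : ℝ} (hε : 0 < ε) : geomSum ε ≠ ∞ := by
  have h : ∀ j : ℕ, (2 : ℝ≥0∞) ^ (-(ε * j)) = ((2 : ℝ≥0∞) ^ (-ε)) ^ j := fun j => by
    rw [← ENNReal.rpow_natCast, ← ENNReal.rpow_mul]; ring_nf
  unfold geomSum
  simp only [h]
  rw [ENNReal.tsum_geometric, ne_eq, ENNReal.inv_eq_top, tsub_eq_zero_iff_le, not_le,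
    ENNReal.rpow_neg]
  exact ENNReal.inv_lt_one.2 (ENNReal.one_lt_rpow ENNReal.one_lt_two hε)

/-- Half of the weight is spent on summability in `rpow_tsum_mul_le`; the other half survives on the
right. No convexity enters, so `t < 1` is allowed. -/
theorem rpow_geom_tsum_le {ε t : ℝ} (ht : 0 < t) (b : ℕ → ℝ≥0∞) :
    (∑' j : ℕ, (2 : ℝ≥0∞) ^ (-(ε * j)) * b j) ^ t ≤
      geomSum (ε / 2) ^ t * ∑' j : ℕ, (2 : ℝ≥0∞) ^ (-(ε / 2 * t * j)) * b j ^ t := by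
  have h := rpow_tsum_mul_le (fun j : ℕ => (2 : ℝ≥0∞) ^ (-(ε / 2 * j)))
    (fun j : ℕ => (2 : ℝ≥0∞) ^ (-(ε / 2 * j)) * b j) ht
  have h₁ : ∀ j : ℕ, (2 : ℝ≥0∞) ^ (-(ε / 2 * j)) * ((2 : ℝ≥0∞) ^ (-(ε / 2 * j)) * b j) =
      (2 : ℝ≥0∞) ^ (-(ε * j)) * b j := fun j => by
    rw [← mul_assoc, ← two_rpow_add]; ring_nf
  have h₂ : ∀ j : ℕ, ((2 : ℝ≥0∞) ^ (-(ε / 2 * j)) * b j) ^ t =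
      (2 : ℝ≥0∞) ^ (-(ε / 2 * t * j)) * b j ^ t := fun j => by
    rw [ENNReal.mul_rpow_of_nonneg _ _ ht.le, ← ENNReal.rpow_mul]; ring_nf
  simpa only [h₁, h₂, geomSum] using h

/-- One factor `2^{-εj}` is kept to sum over `j`; the other joins `2^{-εi}` to form the weight of `m
= j + i`, and for fixed `j` the sum over `i` is part of the sum over `m`. -/
theorem geom_tsum_tsum_le {ε₁ ε₂ ε : ℝ} (h₁ : 2 * ε ≤ ε₁) (h₂ : ε ≤ ε₂) (c : ℕ → ℝ≥0∞) :
    ∑' j : ℕ, (2 : ℝ≥0∞) ^ (-(ε₁ * j)) * ∑' i : ℕ, (2 : ℝ≥0∞) ^ (-(ε₂ * i)) * c (j + i) ≤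
      geomSum ε * ∑' m : ℕ, (2 : ℝ≥0∞) ^ (-(ε * m)) * c m := by
  unfold geomSum
  rw [← ENNReal.tsum_mul_right]
  refine ENNReal.tsum_le_tsum fun j => ?_
  calc (2 : ℝ≥0∞) ^ (-(ε₁ * j)) * ∑' i : ℕ, (2 : ℝ≥0∞) ^ (-(ε₂ * i)) * c (j + i)
      ≤ (2 : ℝ≥0∞) ^ (-(2 * ε * j)) * ∑' i : ℕ, (2 : ℝ≥0∞) ^ (-(ε * i)) * c (j + i) := by
        gcongr
        · exact one_le_two
        · exact one_le_two
    _ = (2 : ℝ≥0∞) ^ (-(ε * j)) *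
          ∑' i : ℕ, (fun m : ℕ => (2 : ℝ≥0∞) ^ (-(ε * m)) * c m) (j + i) := by
        rw [← ENNReal.tsum_mul_left, ← ENNReal.tsum_mul_left]
        refine tsum_congr fun i => ?_
        rw [← mul_assoc, ← mul_assoc, ← two_rpow_add, ← two_rpow_add]
        push_cast; ring_nf
    _ ≤ _ := by
        refine mul_le_mul_right ?_ _
        exact ENNReal.tsum_comp_le_tsum_of_injective (add_right_injective j) _

theorem lqNorm_mono {q : ℝ≥0∞} {a b : ℤ → ℝ≥0∞} (h : ∀ k, a k ≤ b k) :
    lqNorm q a ≤ lqNorm q b := by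
  unfold lqNorm
  split_ifs
  · exact iSup_mono h
  · gcongr
    exact h _

theorem lqNorm_const_mul {q : ℝ≥0∞} (hq : 0 < q) (c : ℝ≥0∞) (a : ℤ → ℝ≥0∞) :
    lqNorm q (fun k => c * a k) = c * lqNorm q a := by
  unfold lqNorm
  split_ifs with h
  · rw [ENNReal.mul_iSup]
  · have hq' := ENNReal.toReal_pos hq.ne' h
    simp only [ENNReal.mul_rpow_of_nonneg _ _ hq'.le]
    rw [ENNReal.tsum_mul_left, ENNReal.mul_rpow_of_nonneg _ _ (by positivity), ← ENNReal.rpow_mul,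
      mul_one_div_cancel hq'.ne', ENNReal.rpow_one]

theorem le_lqNorm {q : ℝ≥0∞} (hq : 0 < q) (a : ℤ → ℝ≥0∞) (k : ℤ) : a k ≤ lqNorm q a := by
  unfold lqNorm
  split_ifs with h
  · exact le_iSup a k
  · rw [le_ennreal_rpow_one_div_iff (ENNReal.toReal_pos hq.ne' h)]
    exact ENNReal.le_tsum k

/-- A discrete Hardy inequality. -/
theorem exists_lqNorm_geom_tsum_le {q : ℝ≥0∞} (hq : 0 < q) {ε : ℝ} (hε : 0 < ε) :
    ∃ C : ℝ≥0∞, C ≠ ∞ ∧ ∀ (m : ℤ) (a : ℤ → ℝ≥0∞),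
      lqNorm q (fun k => ∑' j : ℕ, (2 : ℝ≥0∞) ^ (-(ε * j)) * a (k + m + j)) ≤ C * lqNorm q a := by
  by_cases h : q = ∞
  · refine ⟨geomSum ε, geomSum_ne_top hε, fun m a => ?_⟩
    simp only [lqNorm, h, if_true]
    refine iSup_le fun k => ?_
    unfold geomSum
    rw [← ENNReal.tsum_mul_right]
    refine ENNReal.tsum_le_tsum fun j => ?_
    gcongr
    exact le_iSup a _
  · have hq' := ENNReal.toReal_pos hq.ne' h
    set t := q.toReal
    refine ⟨(geomSum (ε / 2) ^ t * geomSum (ε / 2 * t)) ^ (1 / t), ?_, fun m a => ?_⟩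
    · have h1 := geomSum_ne_top (half_pos hε)
      have h2 := geomSum_ne_top (mul_pos (half_pos hε) hq')
      have h3 : 0 ≤ 1 / t := by positivity
      finiteness
    · simp only [lqNorm, h, if_false]
      rw [← ENNReal.mul_rpow_of_nonneg _ _ (by positivity : 0 ≤ 1 / t)]
      refine ENNReal.rpow_le_rpow ?_ (by positivity)
      calc _ ≤ ∑' k : ℤ, geomSum (ε / 2) ^ t *
              ∑' j : ℕ, (2 : ℝ≥0∞) ^ (-(ε / 2 * t * j)) * a (k + m + j) ^ t :=
            ENNReal.tsum_le_tsum fun k => rpow_geom_tsum_le hq' _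
        _ = geomSum (ε / 2) ^ t * ∑' j : ℕ, (2 : ℝ≥0∞) ^ (-(ε / 2 * t * j)) *
              ∑' k : ℤ, a (k + m + j) ^ t := by
            rw [ENNReal.tsum_mul_left, ENNReal.tsum_comm]
            simp only [ENNReal.tsum_mul_left]
        _ = _ := by
            have h4 : ∀ j : ℕ, ∑' k : ℤ, a (k + m + j) ^ t = ∑' k, a k ^ t := fun j => by
              rw [← (Equiv.addRight (m + (j : ℤ))).tsum_eq (fun k => a k ^ t)]
              simp [add_assoc]
            simp only [h4]
            rw [ENNReal.tsum_mul_right, mul_assoc]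
            rfl

theorem eLpNorm_ennreal_eq {α : Type*} [MeasurableSpace α] {μ : Measure α} {p : ℝ≥0∞} (hp : p ≠ 0)
    (hp' : p ≠ ∞) (F : α → ℝ≥0∞) :
    eLpNorm F p μ = (∫⁻ x, F x ^ p.toReal ∂μ) ^ (1 / p.toReal) := by
  simp [eLpNorm_eq_lintegral_rpow_enorm_toReal hp hp', enorm_eq_self]

theorem eLpNorm_ennreal_mono_ae {α : Type*} [MeasurableSpace α] {μ : Measure α} {p : ℝ≥0∞}
    {F G : α → ℝ≥0∞} (h : ∀ᵐ x ∂μ, F x ≤ G x) : eLpNorm F p μ ≤ eLpNorm G p μ :=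
  eLpNorm_mono_enorm_ae (by simpa using h)

theorem eLpNorm_ennreal_mul_le {α : Type*} [MeasurableSpace α] {μ : Measure α} {p : ℝ≥0∞}
    (hp : p ≠ 0) {c : ℝ≥0∞} (hc : c ≠ ∞) (F : α → ℝ≥0∞) :
    eLpNorm (fun x => c * F x) p μ = c * eLpNorm F p μ := by
  by_cases hp' : p = ∞
  · subst hp'
    simp only [eLpNorm_exponent_top, eLpNormEssSup, enorm_eq_self]
    exact ENNReal.essSup_const_mul
  · have h0 := ENNReal.toReal_pos hp hp'
    rw [eLpNorm_ennreal_eq hp hp', eLpNorm_ennreal_eq hp hp']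
    simp only [ENNReal.mul_rpow_of_nonneg _ _ h0.le]
    rw [lintegral_const_mul' _ _ (by finiteness),
      ENNReal.mul_rpow_of_nonneg _ _ (by positivity), ← ENNReal.rpow_mul,
      mul_one_div_cancel h0.ne', ENNReal.rpow_one]

/-- Substitute for Minkowski's inequality when `p < 1`. For finite `p`, `rpow_geom_tsum_le` is used
with exponent `p` and then `1/p`; each use halves the decay, whence `ε/4`. The constant does not
depend on the measure, so the bound also applies to normalised restrictions of `μ`. -/
theorem exists_eLpNorm_geom_tsum_le {α : Type*} [MeasurableSpace α] {p : ℝ≥0∞} (hp : p ≠ 0)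
    {ε : ℝ} (hε : 0 < ε) :
    ∃ C : ℝ≥0∞, C ≠ ∞ ∧ ∀ (μ : Measure α) (F : ℕ → α → ℝ≥0∞), (∀ j, AEMeasurable (F j) μ) →
      eLpNorm (fun x => ∑' j : ℕ, (2 : ℝ≥0∞) ^ (-(ε * j)) * F j x) p μ ≤
        C * ∑' j : ℕ, (2 : ℝ≥0∞) ^ (-(ε / 4 * j)) * eLpNorm (F j) p μ := by
  by_cases hp' : p = ∞
  · subst hp'
    refine ⟨1, by simp, fun μ F hF => ?_⟩
    rw [one_mul, eLpNorm_exponent_top]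
    simp only [eLpNormEssSup, enorm_eq_self]
    refine essSup_le_of_ae_le _ ?_
    filter_upwards [ae_all_iff.2 fun j => ENNReal.ae_le_essSup (μ := μ) (F j)] with x hx
    refine ENNReal.tsum_le_tsum fun j => ?_
    gcongr
    · exact one_le_two
    · linarith
    · simpa [eLpNormEssSup] using hx j
  · have h0 := ENNReal.toReal_pos hp hp'
    set t := p.toReal with ht
    have h1 := geomSum_ne_top (half_pos hε)
    have h2 := geomSum_ne_top (ε := ε / 2 * t / 2) (by positivity)
    have h3 : 0 ≤ 1 / t := by positivity
    refine ⟨(geomSum (ε / 2) ^ t) ^ (1 / t) * geomSum (ε / 2 * t / 2) ^ (1 / t),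
      by finiteness, fun μ F hF => ?_⟩
    rw [eLpNorm_ennreal_eq hp hp']
    simp only [eLpNorm_ennreal_eq hp hp', ← ht]
    calc _ ≤ (∫⁻ x, geomSum (ε / 2) ^ t *
            ∑' j : ℕ, (2 : ℝ≥0∞) ^ (-(ε / 2 * t * j)) * F j x ^ t ∂μ) ^ (1 / t) := by
          gcongr with x
          exact rpow_geom_tsum_le h0 _
      _ = (geomSum (ε / 2) ^ t) ^ (1 / t) *
            (∑' j : ℕ, (2 : ℝ≥0∞) ^ (-(ε / 2 * t * j)) * ∫⁻ x, F j x ^ t ∂μ) ^ (1 / t) := by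
          rw [lintegral_const_mul' _ _ (by finiteness), ENNReal.mul_rpow_of_nonneg _ _ h3,
            lintegral_tsum fun j => ((hF j).pow_const t).const_mul _]
          congr 3; ext j
          rw [lintegral_const_mul' _ _ (two_rpow_ne_top _)]
      _ ≤ _ := by
          rw [mul_assoc]
          gcongr
          refine (rpow_geom_tsum_le (by positivity) _).trans (le_of_eq ?_)
          congr 2; ext j
          congr 2
          ring_nf; field_simp

end Discrete

/-! ### Doubling measures -/

section Doubling

variable {Z : Type*} [MetricSpace Z] [MeasurableSpace Z]

/-- `μ` is doubling with dimension `Q`: balls have positive and finite measure, and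
`μ(B(ξ,tr)) ≤ D t^Q μ(B(ξ,r))` for `t ≥ 1`. -/
structure HasDoublingDim (μ : Measure Z) (D : ℝ≥0∞) (Q : ℝ) : Prop where
  pos : ∀ (ξ : Z) (r : ℝ), 0 < r → 0 < μ (ball ξ r)
  fin : ∀ (ξ : Z) (r : ℝ), 0 < r → μ (ball ξ r) < ∞
  const_ne_top : D ≠ ∞
  dim_pos : 0 < Q
  doubling : ∀ (ξ : Z) (r t : ℝ), 0 < r → 1 ≤ t →
    μ (ball ξ (t * r)) ≤ D * ENNReal.ofReal t ^ Q * μ (ball ξ r)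

variable {μ : Measure Z} {D : ℝ≥0∞} {Q : ℝ}

theorem HasDoublingDim.measure_ball_le (h : HasDoublingDim μ D Q) {ξ η : Z} {R r t : ℝ}
    (hr : 0 < r) (ht : 1 ≤ t) (hd : dist ξ η + R ≤ t * r) :
    μ (ball ξ R) ≤ D * ENNReal.ofReal t ^ Q * μ (ball η r) :=
  (measure_mono (ball_subset_ball' (by linarith))).trans (h.doubling η r t hr ht)

/-- The bound for the number of balls `B(y, λ2^{-n})`, `y` in a `2^{-n-1}`-separated set, that
contain a given point. -/
def overlapBound (D : ℝ≥0∞) (Q lam : ℝ) : ℝ≥0∞ := D * ENNReal.ofReal (8 * lam + 4) ^ Q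

theorem HasDoublingDim.overlapBound_ne_top (h : HasDoublingDim μ D Q) (lam : ℝ) :
    overlapBound D Q lam ≠ ∞ := by
  have h1 := h.const_ne_top
  have h2 := h.dim_pos.le
  unfold overlapBound
  finiteness

end Doubling

/-! ### Geometry of the filling: overlap, countability, bounded degree -/

namespace HyperbolicFilling

variable {Z : Type*} [MetricSpace Z]

theorem zpow_neg_sub_one (n : ℤ) : (2 : ℝ) ^ (-n - 1) = (2 : ℝ) ^ (-n) / 2 := by
  rw [zpow_sub_one₀ two_ne_zero, div_eq_mul_inv]

theorem le_dist_of_mem_net (X : HyperbolicFilling Z) {n : ℤ} {a b : Z} (ha : a ∈ X.net n)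
    (hb : b ∈ X.net n) (hab : a ≠ b) : (2 : ℝ) ^ (-n) / 2 ≤ dist a b := by
  rw [← zpow_neg_sub_one]
  exact (X.maximal_net n).1 ha hb hab

theorem exists_mem_net (X : HyperbolicFilling Z) (n : ℤ) (ξ : Z) :
    ∃ y ∈ X.net n, dist ξ y < (2 : ℝ) ^ (-n) / 2 := by
  by_contra! hcon
  have hpos : (0 : ℝ) < 2 ^ (-n) := by positivity
  have h1 : (insert ξ (X.net n)).Pairwise fun a b => (2 : ℝ) ^ (-n - 1) ≤ dist a b := by
    refine (X.maximal_net n).1.insert fun b hb _ => ?_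
    rw [zpow_neg_sub_one, dist_comm b ξ]
    exact ⟨hcon b hb, hcon b hb⟩
  have h2 := (X.maximal_net n).2 h1 (Set.subset_insert _ _) (Set.mem_insert _ _)
  have := hcon ξ h2
  rw [dist_self] at this
  linarith

theorem dist_center_lt_of_adj (X : HyperbolicFilling Z) {x y : X.Vertex} (h : X.graph.Adj x y) :
    dist (X.center x) (X.center y) < 2 ^ (-X.level x) + 2 ^ (-X.level y) := by
  obtain ⟨z, hz1, hz2⟩ := h.2.1
  exact (dist_triangle_left _ _ z).trans_lt (add_lt_add hz1 hz2)

theorem level_le_of_adj (X : HyperbolicFilling Z) {x y : X.Vertex} (h : X.graph.Adj x y) :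
    X.level y ≤ X.level x + 1 := by
  have := abs_le.1 h.2.2
  omega

theorem zpow_level_le_of_adj (X : HyperbolicFilling Z) {x y : X.Vertex} (h : X.graph.Adj x y) :
    (2 : ℝ) ^ (-X.level x) ≤ 2 * 2 ^ (-X.level y) := by
  have h1 := X.level_le_of_adj h
  calc (2 : ℝ) ^ (-X.level x) ≤ 2 ^ (-X.level y + 1) := zpow_le_zpow_right₀ one_le_two (by omega)
    _ = _ := by rw [zpow_add_one₀ two_ne_zero]; ring

theorem enorm_sub_le_derivLength (X : HyperbolicFilling Z) (u : X.Vertex → ℂ) {x y : X.Vertex}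
    (h : X.graph.Adj x y) : ‖u y - u x‖ₑ ≤ X.derivLength u x := by
  unfold derivLength
  rw [le_ennreal_rpow_one_div_iff two_pos, ENNReal.rpow_ofNat]
  exact ENNReal.le_tsum (f := fun y : X.graph.neighborSet x => ‖u y - u x‖ₑ ^ 2) ⟨y, h⟩

variable [MeasurableSpace Z] {μ : Measure Z} {D : ℝ≥0∞} {Q : ℝ}

/-- Packing argument: the balls of radius `r/4` about net points are disjoint, those that count lie
in `B(ξ, (λ+1)r)`, and each has measure comparable to that ball, as `(2λ+1)r = (8λ+4)(r/4)`. -/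
theorem tsum_indicator_ball_le [BorelSpace Z] (h : HasDoublingDim μ D Q) (X : HyperbolicFilling Z)
    (n : ℤ) {lam : ℝ} (hl : 0 < lam) (ξ : Z) :
    ∑' y : X.net n, (ball (y : Z) (lam * 2 ^ (-n))).indicator (fun _ => (1 : ℝ≥0∞)) ξ ≤
      overlapBound D Q lam := by
  set r : ℝ := 2 ^ (-n) with hr
  have hr0 : 0 < r := by positivity
  set M := μ (ball ξ ((lam + 1) * r))
  have hM0 : M ≠ 0 := (h.pos _ _ (by positivity)).ne'
  have hM1 : M ≠ ∞ := (h.fin _ _ (by positivity)).ne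
  -- The second set is everything or empty, according to whether `y` counts; this selects the
  -- relevant net points without passing to a subtype.
  have hdisj : Pairwise (Function.onFun Disjoint
      fun y : X.net n => ball (y : Z) (r / 4) ∩ {_z | ξ ∈ ball (y : Z) (lam * r)}) := by
    intro a b hab
    refine Disjoint.mono Set.inter_subset_left Set.inter_subset_left (ball_disjoint_ball ?_)
    have := X.le_dist_of_mem_net a.2 b.2 (fun e => hab (Subtype.ext e))
    linarith
  have h1 := tsum_meas_le_meas_iUnion_of_disjoint μ
    (fun y => measurableSet_ball.inter (MeasurableSet.const _)) hdisj
  have h2 : (⋃ y : X.net n, ball (y : Z) (r / 4) ∩ {_z | ξ ∈ ball (y : Z) (lam * r)}) ⊆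
      ball ξ ((lam + 1) * r) := by
    refine Set.iUnion_subset fun y z hz => ?_
    have hz1 : dist z y < r / 4 := hz.1
    have hz2 : dist ξ y < lam * r := hz.2
    rw [mem_ball]
    have := dist_triangle_right z ξ y
    linarith
  have h3 : ∀ y : X.net n, (ball (y : Z) (lam * r)).indicator (fun _ => (1 : ℝ≥0∞)) ξ * M ≤
      overlapBound D Q lam * μ (ball (y : Z) (r / 4) ∩ {_z | ξ ∈ ball (y : Z) (lam * r)}) := by
    intro y
    by_cases hy : ξ ∈ ball (y : Z) (lam * r)
    · have hy' : dist ξ y < lam * r := hy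
      simp only [hy, Set.indicator_of_mem, one_mul, Set.ofPred_true, Set.inter_univ]
      exact h.measure_ball_le (by positivity) (by linarith) (by linarith)
    · simp [hy]
  rw [← ENNReal.mul_le_mul_iff_left hM0 hM1, ← ENNReal.tsum_mul_right]
  calc _ ≤ ∑' y : X.net n, overlapBound D Q lam *
          μ (ball (y : Z) (r / 4) ∩ {_z | ξ ∈ ball (y : Z) (lam * r)}) := ENNReal.tsum_le_tsum h3
    _ ≤ _ := by
      rw [ENNReal.tsum_mul_left]
      gcongr
      exact h1.trans (measure_mono h2)

theorem countable_net [BorelSpace Z] (h : HasDoublingDim μ D Q) (X : HyperbolicFilling Z) (n : ℤ) :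
    Countable (X.net n) := by
  rcases (X.net n).eq_empty_or_nonempty with he | ⟨ξ, -⟩
  · rw [he]; infer_instance
  rw [← Set.countable_univ_iff]
  have hpos : (0 : ℝ) < 2 ^ (-n) := by positivity
  have h1 : ∀ m : ℕ, (Function.support fun y : X.net n =>
      (ball (y : Z) ((m + 1) * 2 ^ (-n))).indicator (fun _ => (1 : ℝ≥0∞)) ξ).Countable := fun m =>
    Summable.countable_support_ennreal (ne_top_of_le_ne_top (h.overlapBound_ne_top _)
      (X.tsum_indicator_ball_le h n (by positivity) ξ))
  refine (Set.countable_iUnion h1).mono fun y _ => ?_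
  obtain ⟨m, hm⟩ := exists_nat_gt (dist ξ y / 2 ^ (-n))
  refine Set.mem_iUnion.2 ⟨m, ?_⟩
  rw [div_lt_iff₀ hpos] at hm
  have : ξ ∈ ball (y : Z) ((m + 1) * 2 ^ (-n)) := by
    rw [mem_ball]; nlinarith
  simp only [Function.mem_support, Set.indicator_of_mem this]
  exact one_ne_zero

theorem secondCountableTopology [BorelSpace Z] (h : HasDoublingDim μ D Q)
    (X : HyperbolicFilling Z) : SecondCountableTopology Z := by
  have : TopologicalSpace.SeparableSpace Z := by
    refine ⟨⋃ n : ℤ, X.net n, Set.countable_iUnion fun n => ?_, ?_⟩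
    · exact Set.countable_coe_iff.1 (X.countable_net h n)
    · rw [dense_iff]
      intro ξ r hr
      obtain ⟨m, hm⟩ := exists_pow_lt_of_lt_one hr (by norm_num : (1 / 2 : ℝ) < 1)
      obtain ⟨y, hy, hd⟩ := X.exists_mem_net m ξ
      refine ⟨y, ?_, Set.mem_iUnion.2 ⟨m, hy⟩⟩
      rw [mem_ball']
      have h2 : (2 : ℝ) ^ (-(m : ℤ)) = (1 / 2) ^ m := by simp
      rw [h2] at hd
      have : (0 : ℝ) < (1 / 2) ^ m := by positivity
      linarith
  exact UniformSpace.secondCountable_of_separable Z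

/-- Neighbours of `x` occupy at most three levels, and `B(ξ_y, 3·2^{-|y|})` contains `ξ_x` for each
neighbour `y`, so the overlap bound applies level by level. -/
theorem tsum_neighborSet_le [BorelSpace Z] (h : HasDoublingDim μ D Q) (X : HyperbolicFilling Z)
    (x : X.Vertex) :
    ∑' _y : X.graph.neighborSet x, (1 : ℝ≥0∞) ≤ 3 * overlapBound D Q 3 := by
  set k := X.level x with hk
  let F : X.Vertex → ℝ≥0∞ := fun y => (if |k - y.1| ≤ 1 then 1 else 0) *
    (ball (y.2 : Z) (3 * 2 ^ (-y.1))).indicator (fun _ => (1 : ℝ≥0∞)) (X.center x)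
  have h1 : ∀ y : X.graph.neighborSet x, 1 ≤ F y := by
    rintro ⟨y, hy : X.graph.Adj x y⟩
    have hm : X.center x ∈ ball (y.2 : Z) (3 * 2 ^ (-y.1)) := by
      rw [mem_ball]
      have h2 := X.dist_center_lt_of_adj hy
      have h3 := X.zpow_level_le_of_adj hy
      change dist (X.center x) (X.center y) < 3 * 2 ^ (-X.level y)
      linarith
    have h4 : |k - y.1| ≤ 1 := hy.2.2
    simp only [F, hm, h4, if_true, Set.indicator_of_mem, one_mul, le_refl]
  calc _ ≤ ∑' y : X.graph.neighborSet x, F y := ENNReal.tsum_le_tsum h1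
    _ ≤ ∑' y, F y := ENNReal.tsum_comp_le_tsum_of_injective Subtype.val_injective F
    _ = ∑' (n : ℤ) (y : X.net n), F ⟨n, y⟩ := ENNReal.tsum_sigma' F
    _ ≤ ∑' n : ℤ, (if |k - n| ≤ 1 then 1 else 0) * overlapBound D Q 3 := by
      refine ENNReal.tsum_le_tsum fun n => ?_
      refine (ENNReal.tsum_mul_left (a := if |k - n| ≤ 1 then 1 else 0)).le.trans ?_
      gcongr
      exact X.tsum_indicator_ball_le h n (by norm_num) _
    _ = _ := by
      rw [ENNReal.tsum_mul_right, tsum_eq_sum (s := Finset.Icc (k - 1) (k + 1))]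
      · congr 1
        rw [Finset.sum_congr rfl (g := fun _ => (1 : ℝ≥0∞))]
        · have : (k + 1 + 1 - (k - 1)).toNat = 3 := by omega
          simp [this]
        · intro n hn
          rw [Finset.mem_Icc] at hn
          rw [if_pos (abs_le.2 ⟨by omega, by omega⟩)]
      · intro n hn
        rw [Finset.mem_Icc] at hn
        rw [if_neg]
        intro h5
        have := abs_le.1 h5
        exact hn ⟨by omega, by omega⟩

theorem derivLength_le [BorelSpace Z] (h : HasDoublingDim μ D Q) (X : HyperbolicFilling Z)
    (u : X.Vertex → ℂ) (x : X.Vertex) {M : ℝ≥0∞}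
    (hM : ∀ y, X.graph.Adj x y → ‖u y - u x‖ₑ ≤ M) :
    X.derivLength u x ≤ (3 * overlapBound D Q 3) ^ (1 / 2 : ℝ) * M := by
  unfold derivLength
  have h1 : ∑' y : X.graph.neighborSet x, ‖u y - u x‖ₑ ^ 2 ≤ 3 * overlapBound D Q 3 * M ^ 2 := by
    calc _ ≤ ∑' _y : X.graph.neighborSet x, 1 * M ^ 2 := by
          refine ENNReal.tsum_le_tsum fun y => ?_
          rw [one_mul]
          gcongr
          exact hM y y.2
      _ ≤ _ := by
          rw [ENNReal.tsum_mul_right]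
          gcongr
          exact X.tsum_neighborSet_le h x
  refine (ENNReal.rpow_le_rpow h1 (by norm_num)).trans (le_of_eq ?_)
  rw [ENNReal.mul_rpow_of_nonneg _ _ (by norm_num), ← ENNReal.rpow_natCast_mul]
  norm_num

end HyperbolicFilling

theorem enorm_setAverage_sub_le {α : Type*} [MeasurableSpace α] {μ : Measure α} {B : Set α}
    (hB0 : μ B ≠ 0) (hB : μ B ≠ ∞) {f : α → ℂ} (hf : IntegrableOn f B μ) (c : ℂ) :
    ‖(⨍ x in B, f x ∂μ) - c‖ₑ ≤ (μ B)⁻¹ * ∫⁻ x in B, ‖f x - c‖ₑ ∂μ := by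
  have hr : μ.real B ≠ 0 := (measureReal_ne_zero_iff hB).2 hB0
  have h1 : (⨍ x in B, f x ∂μ) - c = (μ.real B)⁻¹ • ∫ x in B, (f x - c) ∂μ := by
    rw [integral_sub hf (integrableOn_const hB), setIntegral_const, smul_sub, smul_smul,
      inv_mul_cancel₀ hr, one_smul, setAverage_eq]
  rw [h1, enorm_smul, enorm_inv hr, Real.enorm_eq_ofReal measureReal_nonneg, ofReal_measureReal hB]
  gcongr
  exact enorm_integral_le_lintegral_enorm _

/-! ### Convergence of the Poisson extension and the gradient it produces -/

namespace HyperbolicFilling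

variable {Z : Type*} [MetricSpace Z]

/-- The function `∑_{x ∈ X_n} w(x) χ_{B(x)}` on `Z`. -/
def levelSum (X : HyperbolicFilling Z) (w : X.Vertex → ℝ≥0∞) (n : ℤ) (ξ : Z) : ℝ≥0∞ :=
  ∑' x : X.net n, (X.vball ⟨n, x⟩).indicator (fun _ => w ⟨n, x⟩) ξ

theorem le_levelSum (X : HyperbolicFilling Z) (w : X.Vertex → ℝ≥0∞) {x : X.Vertex} {ξ : Z}
    (hx : ξ ∈ X.vball x) : w x ≤ X.levelSum w (X.level x) ξ := by
  have h1 := ENNReal.le_tsum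
    (f := fun y : X.net x.1 => (X.vball ⟨x.1, y⟩).indicator (fun _ => w ⟨x.1, y⟩) ξ) x.2
  have h2 : ξ ∈ X.vball ⟨x.1, x.2⟩ := hx
  rwa [Set.indicator_of_mem h2] at h1

/-- The nets are maximal, so every level has a ball containing `ξ`; consecutive choices are adjacent
because their balls share `ξ`. -/
theorem exists_vertex_chain (X : HyperbolicFilling Z) (x : X.Vertex) {ξ : Z}
    (hx : ξ ∈ X.vball x) : ∃ c : ℕ → X.Vertex, c 0 = x ∧ (∀ j, X.level (c j) = X.level x + j) ∧
      (∀ j, ξ ∈ X.vball (c j)) ∧ ∀ j, X.graph.Adj (c j) (c (j + 1)) := by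
  have h1 : ∀ n : ℤ, ∃ y : X.Vertex, X.level y = n ∧ ξ ∈ X.vball y := fun n => by
    obtain ⟨y, hy, hd⟩ := X.exists_mem_net n ξ
    refine ⟨⟨n, y, hy⟩, rfl, ?_⟩
    have : (0 : ℝ) < 2 ^ (-n) := by positivity
    exact hd.trans (half_lt_self this)
  choose y hy1 hy2 using h1
  have hl : ∀ j : ℕ, X.level (if j = 0 then x else y (X.level x + j)) = X.level x + j := fun j => by
    split_ifs with hj
    · simp [hj]
    · exact hy1 _
  have hm : ∀ j : ℕ, ξ ∈ X.vball (if j = 0 then x else y (X.level x + j)) := fun j => by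
    split_ifs with hj
    · exact hx
    · exact hy2 _
  refine ⟨fun j => if j = 0 then x else y (X.level x + j), by simp, hl, hm, fun j => ?_⟩
  refine ⟨fun e => ?_, ⟨ξ, hm j, hm (j + 1)⟩, ?_⟩
  · have := congrArg X.level e
    rw [hl, hl] at this
    push_cast at this
    omega
  · rw [hl, hl]
    push_cast
    rw [abs_le]
    constructor <;> omega

theorem isBounded_vball (X : HyperbolicFilling Z) (x : X.Vertex) :
    Bornology.IsBounded (X.vball x) := isBounded_ball

variable [MeasurableSpace Z] {μ : Measure Z} {D : ℝ≥0∞} {Q : ℝ}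

theorem measurableSet_vball [BorelSpace Z] (X : HyperbolicFilling Z) (x : X.Vertex) :
    MeasurableSet (X.vball x) := measurableSet_ball

theorem measure_vball_ne_zero (h : HasDoublingDim μ D Q) (X : HyperbolicFilling Z) (x : X.Vertex) :
    μ (X.vball x) ≠ 0 := (h.pos _ _ (by positivity)).ne'

theorem measure_vball_ne_top (h : HasDoublingDim μ D Q) (X : HyperbolicFilling Z) (x : X.Vertex) :
    μ (X.vball x) ≠ ∞ := (h.fin _ _ (by positivity)).ne

theorem measurable_levelSum [BorelSpace Z] (h : HasDoublingDim μ D Q) (X : HyperbolicFilling Z)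
    (w : X.Vertex → ℝ≥0∞) (n : ℤ) : Measurable (X.levelSum w n) := by
  have := X.countable_net h n
  exact Measurable.tsum fun x => measurable_const.indicator (X.measurableSet_vball _)

theorem _root_.HasDoublingDim.isUnifLocDoublingMeasure (h : HasDoublingDim μ D Q) :
    IsUnifLocDoublingMeasure μ := by
  have hQ := h.dim_pos.le
  have hD := h.const_ne_top
  refine ⟨(D * ENNReal.ofReal 4 ^ Q).toNNReal, ?_⟩
  filter_upwards [self_mem_nhdsWithin] with ε (hε : 0 < ε) x
  rw [ENNReal.coe_toNNReal (by finiteness)]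
  calc μ (closedBall x (2 * ε)) ≤ μ (ball x (4 * ε)) :=
        measure_mono (closedBall_subset_ball (by linarith))
    _ ≤ D * ENNReal.ofReal 4 ^ Q * μ (ball x ε) := h.doubling x ε 4 hε (by norm_num)
    _ ≤ _ := by gcongr; exact ball_subset_closedBall

theorem _root_.IsLocL1.locallyIntegrable {f : Z → ℂ} (hf : IsLocL1 μ f) : LocallyIntegrable f μ :=
  fun x => ⟨ball x 1, ball_mem_nhds x one_pos, hf.2 _ isBounded_ball⟩

/-- Lebesgue differentiation for balls that contain `ξ` but need not be centred there. It is
available for closed balls, and doubling transfers the means of `|f - f(ξ)|` to open ones. A single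
null set serves all chains. -/
theorem ae_tendsto_poisson [BorelSpace Z] (h : HasDoublingDim μ D Q) (X : HyperbolicFilling Z)
    {f : Z → ℂ} (hf : IsLocL1 μ f) :
    ∀ᵐ ξ ∂μ, ∀ (k : ℤ) (c : ℕ → X.Vertex), (∀ j, X.level (c j) = k + j) →
      (∀ j, ξ ∈ X.vball (c j)) →
      Filter.Tendsto (fun j => X.poisson μ f (c j)) Filter.atTop (nhds (f ξ)) := by
  have := h.isUnifLocDoublingMeasure
  have := X.secondCountableTopology h
  have : IsLocallyFiniteMeasure μ :=
    ⟨fun x => ⟨ball x 1, ball_mem_nhds x one_pos, h.fin x 1 one_pos⟩⟩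
  have hQ := h.dim_pos.le
  have hD := h.const_ne_top
  filter_upwards [IsUnifLocDoublingMeasure.ae_tendsto_average_norm_sub (μ := μ)
    hf.locallyIntegrable 1] with ξ hξ k c hl hm
  have hδ : Filter.Tendsto (fun j : ℕ => (2 : ℝ) ^ (-X.level (c j))) Filter.atTop
      (nhdsWithin 0 (Set.Ioi 0)) := by
    refine tendsto_nhdsWithin_iff.2 ⟨?_, Filter.Eventually.of_forall fun j => ?_⟩
    · have h1 : ∀ j : ℕ, (2 : ℝ) ^ (-X.level (c j)) = 2 ^ (-k) * (1 / 2) ^ j := fun j => by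
        rw [hl, neg_add, zpow_add₀ two_ne_zero]; simp
      simp only [h1]
      simpa using (tendsto_pow_atTop_nhds_zero_of_lt_one (by norm_num : (0 : ℝ) ≤ 1 / 2)
        (by norm_num)).const_mul ((2 : ℝ) ^ (-k))
    · exact Set.mem_Ioi.2 (by positivity)
  have h2 := hξ (fun j => X.center (c j)) (fun j => (2 : ℝ) ^ (-X.level (c j))) hδ
    (Filter.Eventually.of_forall fun j => by
      rw [one_mul]; exact ball_subset_closedBall (hm j))
  have h3 := ENNReal.Tendsto.const_mul (a := D * ENNReal.ofReal 2 ^ Q)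
    (ENNReal.tendsto_ofReal h2) (Or.inr (by finiteness))
  rw [ENNReal.ofReal_zero, mul_zero] at h3
  rw [tendsto_iff_edist_tendsto_0]
  refine tendsto_of_tendsto_of_tendsto_of_le_of_le tendsto_const_nhds h3 (fun _ => zero_le)
    fun j => ?_
  have hB0 := X.measure_vball_ne_zero h (c j)
  have hB := X.measure_vball_ne_top h (c j)
  have hfB := hf.2 _ (X.isBounded_vball (c j))
  have hfB' := hf.2 _ (isBounded_closedBall (x := X.center (c j)) (r := 2 ^ (-X.level (c j))))
  have hcB : μ (closedBall (X.center (c j)) (2 ^ (-X.level (c j)))) ≤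
      D * ENNReal.ofReal 2 ^ Q * μ (X.vball (c j)) :=
    (measure_mono (closedBall_subset_ball (by
      have : (0 : ℝ) < 2 ^ (-X.level (c j)) := by positivity
      linarith))).trans (h.doubling (X.center (c j)) (2 ^ (-X.level (c j))) 2 (by positivity)
        one_le_two)
  have hcB0 : μ (closedBall (X.center (c j)) (2 ^ (-X.level (c j)))) ≠ 0 :=
    fun e => hB0 (measure_mono_null ball_subset_closedBall e)
  have hcB1 : μ (closedBall (X.center (c j)) (2 ^ (-X.level (c j)))) ≠ ∞ :=
    ne_top_of_le_ne_top (by finiteness) hcB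
  rw [edist_eq_enorm_sub]
  refine (enorm_setAverage_sub_le hB0 hB hfB (f ξ)).trans ?_
  change _ ≤ D * ENNReal.ofReal 2 ^ Q *
    ENNReal.ofReal (⨍ y in closedBall (X.center (c j)) (2 ^ (-X.level (c j))), ‖f y - f ξ‖ ∂μ)
  rw [ofReal_setAverage (f := fun y => ‖f y - f ξ‖) (hfB'.sub (integrableOn_const hcB1)).norm
    (Filter.Eventually.of_forall fun _ => norm_nonneg _)]
  simp only [ofReal_norm]
  rw [ENNReal.div_eq_inv_mul, ← mul_assoc]
  gcongr ?_ * ?_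
  · rw [ENNReal.inv_le_iff_inv_le, ENNReal.mul_inv, inv_inv]
    · rw [mul_comm, ← div_eq_mul_inv]
      exact ENNReal.div_le_of_le_mul' hcB
    · exact Or.inr (ENNReal.inv_ne_top.2 hcB0)
    · exact Or.inr (ENNReal.inv_ne_zero.2 hcB1)
  · exact lintegral_mono_set ball_subset_closedBall

/-- Telescoping: each increment along the chain is at most `|d(Pf)(c_j)|`, which is one of the terms
of the level sum at `ξ`. -/
theorem enorm_sub_poisson_le (X : HyperbolicFilling Z) {f : Z → ℂ} {ξ : Z}
    (hξ : ∀ (k : ℤ) (c : ℕ → X.Vertex), (∀ j, X.level (c j) = k + j) →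
      (∀ j, ξ ∈ X.vball (c j)) →
      Filter.Tendsto (fun j => X.poisson μ f (c j)) Filter.atTop (nhds (f ξ)))
    (x : X.Vertex) (hx : ξ ∈ X.vball x) :
    ‖X.poisson μ f x - f ξ‖ₑ ≤
      ∑' j : ℕ, X.levelSum (X.derivLength (X.poisson μ f)) (X.level x + j) ξ := by
  obtain ⟨c, hc0, hl, hm, hadj⟩ := X.exists_vertex_chain x hx
  have h1 := edist_le_tsum_of_edist_le_of_tendsto₀
    (fun j : ℕ => X.levelSum (X.derivLength (X.poisson μ f)) (X.level x + j) ξ) (fun j => ?_)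
    (hξ _ c hl hm)
  · rwa [hc0, edist_eq_enorm_sub] at h1
  · rw [edist_comm, edist_eq_enorm_sub, ← hl]
    exact (X.enorm_sub_le_derivLength _ (hadj j)).trans (X.le_levelSum _ (hm j))

theorem ofReal_rpow_dist_mul_two_rpow_ge {s : ℝ} (hs : 0 < s) {k : ℤ} {d : ℝ}
    (hd : (2 : ℝ) ^ (-k - 1) ≤ d) :
    1 ≤ ENNReal.ofReal (d ^ s) * (2 : ℝ≥0∞) ^ (((k : ℝ) + 1) * s) := by
  have h1 : (2 : ℝ≥0∞) ^ (-(((k : ℝ) + 1) * s)) ≤ ENNReal.ofReal (d ^ s) := by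
    have h2 : (2 : ℝ≥0∞) ^ (-(((k : ℝ) + 1) * s)) = ENNReal.ofReal (((2 : ℝ) ^ (-k - 1)) ^ s) := by
      rw [← Real.rpow_intCast, ← Real.rpow_mul zero_le_two, ← ENNReal.ofReal_rpow_of_pos two_pos,
        ENNReal.ofReal_ofNat]
      push_cast
      ring_nf
    rw [h2]
    exact ENNReal.ofReal_le_ofReal (Real.rpow_le_rpow (by positivity) hd hs.le)
  calc (1 : ℝ≥0∞) = (2 : ℝ≥0∞) ^ (-(((k : ℝ) + 1) * s)) * 2 ^ (((k : ℝ) + 1) * s) := by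
        rw [← two_rpow_add]; simp
    _ ≤ _ := by gcongr

/-- Both points are compared with `Pf(x)` for one vertex `x`. The value `∞` on the exceptional set
makes the inequality hold for every pair of points; when that set is null, the norms are unaffected.
-/
theorem isHajlaszGradient_levelSum [BorelSpace Z] (h : HasDoublingDim μ D Q) {s : ℝ} (hs : 0 < s)
    (X : HyperbolicFilling Z) {f : Z → ℂ} {N : Set Z} (hNm : MeasurableSet N)
    (hNsub : ∀ ξ ∉ N, ∀ (k : ℤ) (c : ℕ → X.Vertex), (∀ j, X.level (c j) = k + j) →
      (∀ j, ξ ∈ X.vball (c j)) →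
      Filter.Tendsto (fun j => X.poisson μ f (c j)) Filter.atTop (nhds (f ξ))) :
    IsHajlaszGradient μ s f fun k ξ => 2 ^ (((k : ℝ) + 1) * s) *
      (∑' j : ℕ, X.levelSum (X.derivLength (X.poisson μ f)) (k - 1 + j) ξ) +
        N.indicator (fun _ => ∞) ξ := by
  have hGm := X.measurable_levelSum h (X.derivLength (X.poisson μ f))
  refine ⟨fun k => ?_, fun k ξ η hd1 hd2 => ?_⟩
  · exact (((Measurable.tsum fun j => hGm _).const_mul _).add
      (measurable_const.indicator hNm)).aemeasurable
  have hd0 : 0 < dist ξ η := lt_of_lt_of_le (by positivity) hd1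
  have hds : ENNReal.ofReal (dist ξ η ^ s) ≠ 0 := by
    rw [ne_eq, ENNReal.ofReal_eq_zero, not_le]; positivity
  by_cases hξ : ξ ∈ N
  · simp [hξ, ENNReal.mul_top hds]
  by_cases hη : η ∈ N
  · simp [hη, ENNReal.mul_top hds]
  -- At level `k - 1` the net point is within `2^{-k}` of `ξ` and the radius is `2·2^{-k}`, so `η`
  -- lies in the same ball.
  obtain ⟨y, hy, hyd⟩ := X.exists_mem_net (k - 1) ξ
  set x : X.Vertex := ⟨k - 1, y, hy⟩
  have e1 : (2 : ℝ) ^ (-(k - 1)) = 2 * 2 ^ (-k) := by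
    rw [show -(k - 1) = -k + 1 by ring, zpow_add_one₀ two_ne_zero]; ring
  have hξx : ξ ∈ X.vball x := by
    have : (0 : ℝ) < 2 ^ (-(k - 1)) := by positivity
    exact hyd.trans (half_lt_self this)
  have hηx : η ∈ X.vball x := by
    change dist η y < 2 ^ (-(k - 1))
    have := dist_triangle_left η y ξ
    rw [e1] at hyd ⊢
    linarith
  have hξ' := X.enorm_sub_poisson_le (hNsub ξ hξ) x hξx
  have hη' := X.enorm_sub_poisson_le (hNsub η hη) x hηx
  have hl : X.level x = k - 1 := rfl
  rw [hl] at hξ' hη'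
  simp only [hξ, hη, not_false_eq_true, Set.indicator_of_notMem, add_zero]
  rw [← mul_add, ← mul_assoc]
  refine le_trans ?_ (le_mul_of_one_le_left (zero_le) (ofReal_rpow_dist_mul_two_rpow_ge hs hd1))
  rw [← edist_eq_enorm_sub] at hξ' hη' ⊢
  exact (edist_triangle_left _ _ _).trans (add_le_add hξ' hη')

theorem besovNorm_eq (X : HyperbolicFilling Z) (s : ℝ) (p q : ℝ≥0∞) (f : Z → ℂ) :
    X.besovNorm μ s p q f = lqNorm q fun n : ℤ => (2 : ℝ≥0∞) ^ ((n : ℝ) * s) *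
      eLpNorm (X.levelSum (X.derivLength (X.poisson μ f)) n) p μ := rfl

theorem exists_hajlaszNorm_le [BorelSpace Z] (h : HasDoublingDim μ D Q) {s : ℝ} (hs : 0 < s)
    {p q : ℝ≥0∞} (hp : p ≠ 0) (hq : 0 < q) :
    ∃ C : ℝ≥0∞, C ≠ ∞ ∧ ∀ (X : HyperbolicFilling Z) (f : Z → ℂ), IsLocL1 μ f →
      hajlaszNorm μ s p q f ≤ C * X.besovNorm μ s p q f := by
  obtain ⟨C₁, hC₁, h₁⟩ := exists_eLpNorm_geom_tsum_le (α := Z) hp hs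
  obtain ⟨C₂, hC₂, h₂⟩ := exists_lqNorm_geom_tsum_le hq (ε := s / 4) (by positivity)
  have h2t := two_rpow_ne_top (2 * s)
  refine ⟨2 ^ (2 * s) * C₁ * C₂, by finiteness, fun X f hf => ?_⟩
  obtain ⟨N, hNsub, hNm, hN0⟩ :=
    exists_measurable_superset_of_null (ae_iff.1 (X.ae_tendsto_poisson h hf))
  have hg := X.isHajlaszGradient_levelSum h hs hNm fun ξ hξ => not_not.1 fun e => hξ (hNsub e)
  have hGm := X.measurable_levelSum h (X.derivLength (X.poisson μ f))
  rw [besovNorm_eq]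
  generalize X.levelSum (X.derivLength (X.poisson μ f)) = G at hg hGm ⊢
  refine (iInf₂_le _ hg).trans ?_
  have hgk : ∀ k : ℤ, eLpNorm (fun ξ => 2 ^ (((k : ℝ) + 1) * s) *
      (∑' j : ℕ, G (k - 1 + j) ξ) + N.indicator (fun _ => ∞) ξ) p μ ≤
      2 ^ (2 * s) * C₁ * ∑' j : ℕ, (2 : ℝ≥0∞) ^ (-(s / 4 * j)) *
      (fun n : ℤ => (2 : ℝ≥0∞) ^ ((n : ℝ) * s) * eLpNorm (G n) p μ) (k + (-1) + j) := by
    intro k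
    -- Uses `(k+1)s = 2s - sj + (k-1+j)s`, which exposes the decay `2^{-sj}`.
    have e1 : ∀ᵐ ξ ∂μ, 2 ^ (((k : ℝ) + 1) * s) *
        (∑' j : ℕ, G (k - 1 + j) ξ) + N.indicator (fun _ => ∞) ξ ≤
        2 ^ (2 * s) * ∑' j : ℕ, (2 : ℝ≥0∞) ^ (-(s * j)) *
        ((2 : ℝ≥0∞) ^ (((k + (-1) + j : ℤ) : ℝ) * s) * G (k + (-1) + j) ξ) := by
      filter_upwards [compl_mem_ae_iff.2 hN0] with ξ hξ
      have hξ' : ξ ∉ N := hξ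
      simp only [hξ', not_false_eq_true, Set.indicator_of_notMem, add_zero]
      rw [← ENNReal.tsum_mul_left, ← ENNReal.tsum_mul_left]
      refine ENNReal.tsum_le_tsum fun j => ?_
      rw [← mul_assoc, ← mul_assoc, ← two_rpow_add, ← two_rpow_add]
      refine le_of_eq ?_
      congr 2
      push_cast; ring
    refine (eLpNorm_ennreal_mono_ae e1).trans ?_
    rw [eLpNorm_ennreal_mul_le hp h2t, mul_assoc]
    gcongr
    refine (h₁ _ _ fun j => ((hGm _).const_mul _).aemeasurable).trans (le_of_eq ?_)
    simp only [eLpNorm_ennreal_mul_le hp (two_rpow_ne_top _)]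
  refine (lqNorm_mono hgk).trans ?_
  rw [lqNorm_const_mul hq, mul_assoc _ C₂]
  exact mul_le_mul_right (h₂ (-1) fun n : ℤ => (2 : ℝ≥0∞) ^ ((n : ℝ) * s) * eLpNorm (G n) p μ) _

end HyperbolicFilling

/-! ### Means with exponent `p` over sets -/

section PowerMean

variable {α : Type*} [MeasurableSpace α] {μ : Measure α}

/-- The `L^p`-mean `(⨍_E φ^p dμ)^{1/p}`. -/
def powerMean (μ : Measure α) (p : ℝ≥0∞) (φ : α → ℝ≥0∞) (E : Set α) : ℝ≥0∞ :=
  eLpNorm φ p ((μ E)⁻¹ • μ.restrict E)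

theorem powerMean_eq {p : ℝ≥0∞} (hp : p ≠ 0) (hp' : p ≠ ∞) (φ : α → ℝ≥0∞) (E : Set α) :
    powerMean μ p φ E = ((μ E)⁻¹ * ∫⁻ x in E, φ x ^ p.toReal ∂μ) ^ (1 / p.toReal) := by
  rw [powerMean, eLpNorm_ennreal_eq hp hp', lintegral_smul_measure, smul_eq_mul]

theorem powerMean_le_powerMean {p r : ℝ≥0∞} (h : r ≤ p) {φ : α → ℝ≥0∞} (hφ : AEMeasurable φ μ)
    {E : Set α} (hE0 : μ E ≠ 0) (hE : μ E ≠ ∞) : powerMean μ r φ E ≤ powerMean μ p φ E := by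
  have : IsProbabilityMeasure ((μ E)⁻¹ • μ.restrict E) :=
    ⟨by simp [ENNReal.inv_mul_cancel hE0 hE]⟩
  exact eLpNorm_le_eLpNorm_of_exponent_le h
    ((hφ.restrict.smul_measure _).aestronglyMeasurable)

theorem powerMean_le_mul_eLpNorm {p : ℝ≥0∞} {φ : α → ℝ≥0∞} {E : Set α} (hE : μ E ≠ ∞) :
    powerMean μ p φ E ≤ (μ E)⁻¹ ^ (1 / p).toReal * eLpNorm φ p μ := by
  rw [powerMean, eLpNorm_smul_measure_of_ne_zero (ENNReal.inv_ne_zero.2 hE), smul_eq_mul]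
  gcongr
  exact Measure.restrict_le_self

theorem powerMean_mono_set {r : ℝ≥0∞} (hr : r ≠ 0) (hr' : r ≠ ∞) (φ : α → ℝ≥0∞) {E E' : Set α}
    (hEE : E ⊆ E') (hE'0 : μ E' ≠ 0) (hE' : μ E' ≠ ∞) {c : ℝ≥0∞} (hc : μ E' ≤ c * μ E) :
    powerMean μ r φ E ≤ c ^ (1 / r.toReal) * powerMean μ r φ E' := by
  have h0 := ENNReal.toReal_pos hr hr'
  rw [powerMean_eq hr hr', powerMean_eq hr hr', ← ENNReal.mul_rpow_of_nonneg _ _ (by positivity),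
    ← mul_assoc]
  gcongr ?_ ^ _
  gcongr ?_ * ?_
  · have h1 : 1 ≤ c * μ E * (μ E')⁻¹ := by
      rw [← ENNReal.mul_inv_cancel hE'0 hE']
      gcongr
    rcases eq_or_ne (μ E) 0 with hE | hE
    · rw [hE, mul_zero] at hc
      exact absurd (le_antisymm hc zero_le) hE'0
    have hE1 : μ E ≠ ∞ := ne_top_of_le_ne_top hE' (measure_mono hEE)
    calc (μ E)⁻¹ = (μ E)⁻¹ * 1 := (mul_one _).symm
      _ ≤ (μ E)⁻¹ * (c * μ E * (μ E')⁻¹) := by gcongr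
      _ = ((μ E)⁻¹ * μ E) * (c * (μ E')⁻¹) := by ring
      _ = _ := by rw [ENNReal.inv_mul_cancel hE hE1, one_mul]
  · exact lintegral_mono_set hEE

theorem powerMean_mul_le {p : ℝ≥0∞} (hp : p ≠ 0) {c : ℝ≥0∞} (hc : c ≠ ∞) (φ : α → ℝ≥0∞)
    (E : Set α) : powerMean μ p (fun x => c * φ x) E = c * powerMean μ p φ E :=
  eLpNorm_ennreal_mul_le hp hc φ

theorem ae_ne_top_of_eLpNorm_ne_top {p : ℝ≥0∞} (hp : p ≠ 0) {φ : α → ℝ≥0∞}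
    (hφ : AEMeasurable φ μ) (h : eLpNorm φ p μ ≠ ∞) : ∀ᵐ x ∂μ, φ x ≠ ∞ := by
  by_cases hp' : p = ∞
  · subst hp'
    simp only [eLpNorm_exponent_top, eLpNormEssSup, enorm_eq_self] at h
    filter_upwards [ENNReal.ae_le_essSup (μ := μ) φ] with x hx
    exact ne_top_of_le_ne_top h hx
  · have h0 := ENNReal.toReal_pos hp hp'
    rw [eLpNorm_ennreal_eq hp hp'] at h
    have h1 : ∫⁻ x, φ x ^ p.toReal ∂μ ≠ ∞ := fun e => h (by
      rw [e]; exact ENNReal.top_rpow_of_pos (by positivity))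
    filter_upwards [ae_lt_top' (hφ.pow_const _) h1] with x hx e
    rw [e, ENNReal.top_rpow_of_pos h0] at hx
    exact lt_irrefl _ hx

end PowerMean

/-! ### Tails of a Hajłasz gradient -/

section Tail

variable {Z : Type*}

/-- The function `h_k = ∑_{i ≥ k-3} 2^{-is} g_i`. -/
def gradientTail (s : ℝ) (g : ℤ → Z → ℝ≥0∞) (k : ℤ) (ξ : Z) : ℝ≥0∞ :=
  2 ^ (-(s * ((k : ℝ) - 3))) * ∑' i : ℕ, (2 : ℝ≥0∞) ^ (-(s * i)) * g (k - 3 + i) ξ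

theorem gradientTail_eq (s : ℝ) (g : ℤ → Z → ℝ≥0∞) (k : ℤ) (ξ : Z) :
    gradientTail s g k ξ =
      ∑' i : ℕ, (fun n : ℤ => (2 : ℝ≥0∞) ^ (-(s * (n : ℝ))) * g n ξ) (k - 3 + i) := by
  rw [gradientTail, ← ENNReal.tsum_mul_left]
  refine tsum_congr fun i => ?_
  rw [← mul_assoc, ← two_rpow_add]
  push_cast
  ring_nf

theorem gradientTail_add (s : ℝ) (g : ℤ → Z → ℝ≥0∞) (k : ℤ) (j : ℕ) (ξ : Z) :
    gradientTail s g (k + j) ξ = ∑' i : ℕ,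
      (fun m : ℕ => (2 : ℝ≥0∞) ^ (-(s * ((k - 3 + m : ℤ) : ℝ))) * g (k - 3 + m) ξ) (i + j) := by
  rw [gradientTail_eq]
  refine tsum_congr fun i => ?_
  have : k + j - 3 + i = k - 3 + ((i + j : ℕ) : ℤ) := by push_cast; ring
  simp only [this]

theorem gradientTail_antitone (s : ℝ) (g : ℤ → Z → ℝ≥0∞) {k n : ℤ} (hkn : k ≤ n) (ξ : Z) :
    gradientTail s g n ξ ≤ gradientTail s g k ξ := by
  obtain ⟨j, rfl⟩ := Int.le.dest hkn
  rw [gradientTail_add, gradientTail_eq s g k]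
  exact ENNReal.tsum_comp_le_tsum_of_injective (add_left_injective j) _

theorem tendsto_gradientTail {s : ℝ} {g : ℤ → Z → ℝ≥0∞} {k : ℤ} {ξ : Z}
    (h : gradientTail s g k ξ ≠ ∞) :
    Filter.Tendsto (fun j : ℕ => gradientTail s g (k + j) ξ) Filter.atTop (nhds 0) := by
  simp only [gradientTail_add]
  rw [gradientTail_eq] at h
  exact ENNReal.tendsto_sum_nat_add _ h

variable [MeasurableSpace Z] {μ : Measure Z}

theorem aemeasurable_gradientTail {s : ℝ} {g : ℤ → Z → ℝ≥0∞} (hg : ∀ k, AEMeasurable (g k) μ)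
    (k : ℤ) : AEMeasurable (gradientTail s g k) μ :=
  (AEMeasurable.tsum fun _ => (hg _).const_mul _).const_mul _

/-- The Lᵖ-means of the tails of a gradient are controlled by those of the gradient. -/
theorem exists_powerMean_gradientTail_le {r : ℝ≥0∞} (hr : r ≠ 0) {s : ℝ} (hs : 0 < s) :
    ∃ C : ℝ≥0∞, C ≠ ∞ ∧ ∀ (μ : Measure Z) (g : ℤ → Z → ℝ≥0∞), (∀ k, AEMeasurable (g k) μ) →
      ∀ (k : ℤ) (E : Set Z), powerMean μ r (gradientTail s g k) E ≤
        C * (2 ^ (-(s * ((k : ℝ) - 3))) *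
          ∑' i : ℕ, (2 : ℝ≥0∞) ^ (-(s / 4 * i)) * powerMean μ r (g (k - 3 + i)) E) := by
  obtain ⟨C, hC, h⟩ := exists_eLpNorm_geom_tsum_le (α := Z) hr hs
  refine ⟨C, hC, fun μ g hg k E => ?_⟩
  have h1 : powerMean μ r (gradientTail s g k) E = 2 ^ (-(s * ((k : ℝ) - 3))) *
      powerMean μ r (fun ξ => ∑' i : ℕ, (2 : ℝ≥0∞) ^ (-(s * i)) * g (k - 3 + i) ξ) E :=
    powerMean_mul_le hr (two_rpow_ne_top _) _ _
  rw [h1, mul_left_comm]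
  gcongr
  exact h _ (fun i => g (k - 3 + i)) fun i => (hg _).restrict.smul_measure _

theorem ae_gradientTail_ne_top {p q : ℝ≥0∞} (hp : p ≠ 0) (hq : 0 < q) {s : ℝ} (hs : 0 < s)
    {g : ℤ → Z → ℝ≥0∞} (hg : ∀ k, AEMeasurable (g k) μ)
    (hfin : (lqNorm q fun k => eLpNorm (g k) p μ) ≠ ∞) (k : ℤ) :
    ∀ᵐ ξ ∂μ, gradientTail s g k ξ ≠ ∞ := by
  obtain ⟨C, hC, h⟩ := exists_eLpNorm_geom_tsum_le (α := Z) hp hs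
  refine ae_ne_top_of_eLpNorm_ne_top hp (aemeasurable_gradientTail hg k) ?_
  unfold gradientTail
  rw [eLpNorm_ennreal_mul_le hp (two_rpow_ne_top _)]
  refine ENNReal.mul_ne_top (two_rpow_ne_top _)
    (ne_top_of_le_ne_top ?_ (h μ (fun i => g (k - 3 + i)) fun i => hg _))
  refine ENNReal.mul_ne_top hC (ne_top_of_le_ne_top
    (ENNReal.mul_ne_top (geomSum_ne_top (ε := s / 4) (by positivity)) hfin) ?_)
  unfold geomSum
  rw [← ENNReal.tsum_mul_right]
  refine ENNReal.tsum_le_tsum fun i => mul_le_mul_right ?_ _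
  exact le_lqNorm hq (fun k => eLpNorm (g k) p μ) _

variable [MetricSpace Z]

/-- The dyadic scale of `d(ξ,η)` has index at least `k - 3`, so its term is among those of the tail.
The margin `3` accommodates points in adjacent balls, which are less than `8·2^{-n}` apart, `n`
being the larger level. -/
theorem IsHajlaszGradient.edist_le_gradientTail {s : ℝ} (hs : 0 < s) {f : Z → ℂ}
    {g : ℤ → Z → ℝ≥0∞} (hg : IsHajlaszGradient μ s f g) {k : ℤ} {ξ η : Z}
    (hd : dist ξ η < 2 ^ (-k + 3)) :
    edist (f ξ) (f η) ≤ gradientTail s g k ξ + gradientTail s g k η := by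
  rcases eq_or_ne ξ η with rfl | hne
  · simp
  obtain ⟨m, hm1, hm2⟩ := exists_mem_Ico_zpow (dist_pos.2 hne) (one_lt_two (α := ℝ))
  have hmk : m < -k + 3 := (zpow_lt_zpow_iff_right₀ one_lt_two).1 (hm1.trans_lt hd)
  obtain ⟨i, hi⟩ := Int.le.dest (show k - 3 ≤ -m - 1 by omega)
  have h1 := hg.2 (-m - 1) ξ η (by rwa [show -(-m - 1) - 1 = m by ring])
    (by rwa [show -(-m - 1) = m + 1 by ring])
  have h2 : ENNReal.ofReal (dist ξ η ^ s) ≤ 2 ^ (-(s * ((-m - 1 : ℤ) : ℝ))) := by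
    rw [← ENNReal.ofReal_rpow_of_pos (dist_pos.2 hne), mul_comm s, ← neg_mul, ENNReal.rpow_mul]
    refine ENNReal.rpow_le_rpow ?_ hs.le
    refine (ENNReal.ofReal_le_ofReal hm2.le).trans (le_of_eq ?_)
    rw [← Real.rpow_intCast, ← ENNReal.ofReal_rpow_of_pos two_pos, ENNReal.ofReal_ofNat]
    push_cast
    ring_nf
  have h3 : ∀ ζ, 2 ^ (-(s * ((-m - 1 : ℤ) : ℝ))) * g (-m - 1) ζ ≤ gradientTail s g k ζ :=
      fun ζ => by
    rw [gradientTail_eq, ← hi]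
    exact ENNReal.le_tsum (f := fun i : ℕ =>
      (fun n : ℤ => (2 : ℝ≥0∞) ^ (-(s * (n : ℝ))) * g n ζ) (k - 3 + i)) i
  rw [edist_eq_enorm_sub]
  calc _ ≤ _ := h1
    _ ≤ 2 ^ (-(s * ((-m - 1 : ℤ) : ℝ))) * (g (-m - 1) ξ + g (-m - 1) η) := by gcongr
    _ ≤ _ := by rw [mul_add]; exact add_le_add (h3 ξ) (h3 η)

end Tail

/-! ### Telescoping through selected points -/

namespace HyperbolicFilling

variable {Z : Type*} [MetricSpace Z] [MeasurableSpace Z] {μ : Measure Z} {D : ℝ≥0∞} {Q : ℝ}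

/-- A function cannot exceed its mean everywhere. The value of `f` at the selected point stands in
for the average of `f`, which is not yet known to be meaningful. -/
theorem exists_le_powerMean (h : HasDoublingDim μ D Q) (X : HyperbolicFilling Z) {r : ℝ≥0∞}
    (hr : r ≠ 0) (hr' : r ≠ ∞) {φ : Z → ℝ≥0∞} (hφ : AEMeasurable φ μ) (x : X.Vertex) :
    ∃ ζ ∈ X.vball x, φ ζ ≤ powerMean μ r φ (X.vball x) := by
  have h0 := ENNReal.toReal_pos hr hr'
  obtain ⟨ζ, hζ, hle⟩ := exists_le_setLAverage (X.measure_vball_ne_zero h x)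
    (X.measure_vball_ne_top h x) (hφ.pow_const r.toReal).restrict
  refine ⟨ζ, hζ, ?_⟩
  rw [powerMean_eq hr hr', le_ennreal_rpow_one_div_iff h0]
  rwa [setLAverage_eq, ENNReal.div_eq_inv_mul] at hle

theorem edist_le_of_adj {s : ℝ} (hs : 0 < s) {f : Z → ℂ} {g : ℤ → Z → ℝ≥0∞}
    (hg : IsHajlaszGradient μ s f g) (X : HyperbolicFilling Z) {ζ : X.Vertex → Z}
    (hζ : ∀ x, ζ x ∈ X.vball x) {A : X.Vertex → ℝ≥0∞}
    (hA : ∀ x, gradientTail s g (X.level x) (ζ x) ≤ A x) {x y : X.Vertex} (hxy : X.graph.Adj x y) :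
    edist (f (ζ x)) (f (ζ y)) ≤ A x + A y := by
  set n := max (X.level x) (X.level y) with hn
  have h1 := abs_le.1 hxy.2.2
  have e : ∀ z, n ≤ X.level z + 1 → (2 : ℝ) ^ (-X.level z) ≤ 2 * 2 ^ (-n) := fun z hz => by
    calc (2 : ℝ) ^ (-X.level z) ≤ 2 ^ (-n + 1) := zpow_le_zpow_right₀ one_le_two (by omega)
      _ = _ := by rw [zpow_add_one₀ two_ne_zero]; ring
  have ex := e x (by omega)
  have ey := e y (by omega)
  have hx : dist (ζ x) (X.center x) < 2 ^ (-X.level x) := hζ x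
  have hy : dist (ζ y) (X.center y) < 2 ^ (-X.level y) := hζ y
  have hc := X.dist_center_lt_of_adj hxy
  have hd : dist (ζ x) (ζ y) < 2 ^ (-n + 3) := by
    have t1 := dist_triangle4_right (ζ x) (ζ y) (X.center x) (X.center y)
    rw [zpow_add₀ two_ne_zero]
    norm_num
    norm_num at ex ey hx hy hc t1
    linarith
  refine (hg.edist_le_gradientTail hs hd).trans (add_le_add ?_ ?_)
  · exact (gradientTail_antitone s g (le_max_left _ _) _).trans (hA x)
  · exact (gradientTail_antitone s g (le_max_right _ _) _).trans (hA y)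

theorem edist_le_of_mem {s : ℝ} (hs : 0 < s) {f : Z → ℂ} {g : ℤ → Z → ℝ≥0∞}
    (hg : IsHajlaszGradient μ s f g) (X : HyperbolicFilling Z) {ζ : X.Vertex → Z}
    (hζ : ∀ x, ζ x ∈ X.vball x) {A : X.Vertex → ℝ≥0∞}
    (hA : ∀ x, gradientTail s g (X.level x) (ζ x) ≤ A x) {x : X.Vertex} {ξ : Z}
    (hξ : ξ ∈ X.vball x) :
    edist (f (ζ x)) (f ξ) ≤ A x + gradientTail s g (X.level x) ξ := by
  have hd : dist (ζ x) ξ < 2 ^ (-X.level x + 3) := by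
    have hx : dist (ζ x) (X.center x) < 2 ^ (-X.level x) := hζ x
    have hy : dist ξ (X.center x) < 2 ^ (-X.level x) := hξ
    have t1 := dist_triangle_right (ζ x) ξ (X.center x)
    have : (0 : ℝ) < 2 ^ (-X.level x) := by positivity
    have e : (2 : ℝ) ^ (-X.level x + 3) = 2 ^ (-X.level x) * 8 := by
      rw [zpow_add₀ two_ne_zero]; norm_num
    rw [e]
    linarith
  exact (hg.edist_le_gradientTail hs hd).trans (add_le_add_left (hA x) _)

/-- A telescoping estimate along a descending chain of vertices. -/
theorem edist_le_tsum_levelSum {s : ℝ} (hs : 0 < s) {f : Z → ℂ} {g : ℤ → Z → ℝ≥0∞}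
    (hg : IsHajlaszGradient μ s f g) (X : HyperbolicFilling Z) {ζ : X.Vertex → Z}
    (hζ : ∀ x, ζ x ∈ X.vball x) {A : X.Vertex → ℝ≥0∞}
    (hA : ∀ x, gradientTail s g (X.level x) (ζ x) ≤ A x) {x : X.Vertex} {ξ : Z}
    (hξ : ξ ∈ X.vball x) (hfin : gradientTail s g (X.level x) ξ ≠ ∞) :
    edist (f (ζ x)) (f ξ) ≤ 2 * ∑' j : ℕ, X.levelSum A (X.level x + j) ξ := by
  by_cases htop : ∑' j : ℕ, X.levelSum A (X.level x + j) ξ = ∞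
  · rw [htop, ENNReal.mul_top two_ne_zero]; exact le_top
  obtain ⟨c, hc0, hl, hm, hadj⟩ := X.exists_vertex_chain x hξ
  have hAc : ∀ j, A (c j) ≤ X.levelSum A (X.level x + j) ξ := fun j => by
    rw [← hl]; exact X.le_levelSum A (hm j)
  -- The sum converges, so `A (c j)` tends to 0, and so does the tail at `ξ`. The limit is therefore
  -- obtained without Lebesgue differentiation.
  have hlim : Filter.Tendsto (fun j => f (ζ (c j))) Filter.atTop (nhds (f ξ)) := by
    rw [tendsto_iff_edist_tendsto_0]
    have h1 := (ENNReal.tendsto_atTop_zero_of_tsum_ne_top htop).add (tendsto_gradientTail hfin)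
    rw [add_zero] at h1
    refine tendsto_of_tendsto_of_tendsto_of_le_of_le tendsto_const_nhds h1 (fun _ => zero_le)
      fun j => (X.edist_le_of_mem hs hg hζ hA (hm j)).trans ?_
    rw [hl]
    exact add_le_add_left (hAc j) _
  have h2 := edist_le_tsum_of_edist_le_of_tendsto₀
    (fun j : ℕ => X.levelSum A (X.level x + j) ξ + X.levelSum A (X.level x + (j + 1 : ℕ)) ξ)
    (fun j => (X.edist_le_of_adj hs hg hζ hA (hadj j)).trans (add_le_add (hAc j) (hAc (j + 1))))
    hlim
  rw [hc0] at h2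
  refine h2.trans ?_
  -- Each increment is bounded at both of its endpoints, so every level is counted at most twice.
  rw [ENNReal.tsum_add, two_mul]
  refine add_le_add_right ?_ _
  exact ENNReal.tsum_comp_le_tsum_of_injective (add_left_injective 1)
    (fun j : ℕ => X.levelSum A (X.level x + j) ξ)

/-- The two sides differ by `(M/m)^{a-1}` before `M/m` is bounded by `Λ`. With `a = 1/r` this is the
cost of enlarging a small ball to the big one. -/
theorem mul_inv_mul_rpow_le {m M Λ I : ℝ≥0∞} {a : ℝ} (ha : 1 ≤ a) (hm : m ≠ 0) (hm' : m ≠ ∞)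
    (hM : M ≠ 0) (hM' : M ≠ ∞) (h : M ≤ Λ * m) :
    m * (m⁻¹ * I) ^ a ≤ Λ ^ (a - 1) * (M * (M⁻¹ * I) ^ a) := by
  have h1 : m⁻¹ * I = (m⁻¹ * M) * (M⁻¹ * I) := by
    rw [mul_assoc, ← mul_assoc M, ENNReal.mul_inv_cancel hM hM', one_mul]
  have h2 : (m⁻¹ * M) ^ a = (m⁻¹ * M) * (m⁻¹ * M) ^ (a - 1) := by
    conv_lhs => rw [show a = 1 + (a - 1) by ring,
      ENNReal.rpow_add_of_nonneg _ _ zero_le_one (by linarith), ENNReal.rpow_one]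
  have h3 : m⁻¹ * M ≤ Λ := by
    rw [mul_comm, ← div_eq_mul_inv]
    exact ENNReal.div_le_of_le_mul h
  calc m * (m⁻¹ * I) ^ a = m * (m⁻¹ * M) * (m⁻¹ * M) ^ (a - 1) * (M⁻¹ * I) ^ a := by
        rw [h1, ENNReal.mul_rpow_of_nonneg _ _ (by linarith), h2]; ring
    _ = (m⁻¹ * M) ^ (a - 1) * (M * (M⁻¹ * I) ^ a) := by
        rw [← mul_assoc m, ENNReal.mul_inv_cancel hm hm', one_mul]; ring
    _ ≤ _ := by gcongr

theorem tsum_setLIntegral_vball_le [BorelSpace Z] (h : HasDoublingDim μ D Q)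
    (X : HyperbolicFilling Z) (n : ℤ) {lam : ℝ} (hl : 0 < lam) {φ : Z → ℝ≥0∞}
    (hφ : AEMeasurable φ μ) (E : Set Z) :
    ∑' y : X.net n, ∫⁻ ξ in E,
        (ball (y : Z) (lam * 2 ^ (-n))).indicator (fun _ => (1 : ℝ≥0∞)) ξ * φ ξ ∂μ ≤
      overlapBound D Q lam * ∫⁻ ξ in E, φ ξ ∂μ := by
  have := X.countable_net h n
  rw [← lintegral_tsum (f := fun (y : X.net n) ξ =>
      (ball (y : Z) (lam * 2 ^ (-n))).indicator (fun _ => (1 : ℝ≥0∞)) ξ * φ ξ)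
    fun y => ((measurable_const.indicator measurableSet_ball).aemeasurable.mul hφ.restrict),
    ← lintegral_const_mul' _ _ (h.overlapBound_ne_top _)]
  refine lintegral_mono fun ξ => ?_
  simp only [ENNReal.tsum_mul_right]
  gcongr
  exact X.tsum_indicator_ball_le h n hl ξ

/-- Balls of level `|x| + j` meeting `B(x)` lie in `4B(x)` and have measure at least a multiple of
`2^{-jQ}` of it. Since `1/r ≥ 1`, the sum of the powers is at most the power of the sum, and bounded
overlap finishes. -/
theorem setLIntegral_levelSum_powerMean_le [BorelSpace Z] (h : HasDoublingDim μ D Q)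
    (X : HyperbolicFilling Z) {r : ℝ≥0∞} (hr : r ≠ 0) (hr1 : r ≤ 1) {φ : Z → ℝ≥0∞}
    (hφ : AEMeasurable φ μ) (x : X.Vertex) (j : ℕ) (w : X.Vertex → ℝ≥0∞)
    (hw : ∀ y, X.level y = X.level x + j → w y = powerMean μ r φ (X.vball y)) :
    ∫⁻ ξ in X.vball x, X.levelSum w (X.level x + j) ξ ∂μ ≤
      (D * ENNReal.ofReal (8 * 2 ^ j) ^ Q) ^ (1 / r.toReal - 1) *
        overlapBound D Q 1 ^ (1 / r.toReal) *
        (μ (ball (X.center x) (4 * 2 ^ (-X.level x))) *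
          powerMean μ r φ (ball (X.center x) (4 * 2 ^ (-X.level x)))) := by
  set k := X.level x with hk
  set n := k + j with hn
  set E := ball (X.center x) (4 * 2 ^ (-k))
  have hr' : r ≠ ∞ := ne_top_of_le_ne_top ENNReal.one_ne_top hr1
  have h0 := ENNReal.toReal_pos hr hr'
  have ha : 1 ≤ 1 / r.toReal := by
    rw [le_div_iff₀ h0, one_mul]
    exact ENNReal.toReal_le_of_le_ofReal zero_le_one (by simpa using hr1)
  have hk0 : (0 : ℝ) < 2 ^ (-k) := by positivity
  have hnk : (2 : ℝ) ^ (-k) = 2 ^ j * 2 ^ (-n) := by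
    rw [hn, neg_add, zpow_add₀ two_ne_zero]; field_simp; simp
  have hn0 : (0 : ℝ) < 2 ^ (-n) := by positivity
  have hj1 : (1 : ℝ) ≤ 2 ^ j := one_le_pow₀ one_le_two
  have hM0 : μ E ≠ 0 := (h.pos _ _ (by positivity)).ne'
  have hM : μ E ≠ ∞ := (h.fin _ _ (by positivity)).ne
  have := X.countable_net h n
  set a := 1 / r.toReal
  -- Stated for all `y`: the left side vanishes when `B(y)` misses `B(x)`.
  have hterm : ∀ y : X.net n,
      ∫⁻ ξ in X.vball x, (X.vball ⟨n, y⟩).indicator (fun _ => w ⟨n, y⟩) ξ ∂μ ≤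
      (D * ENNReal.ofReal (8 * 2 ^ j) ^ Q) ^ (a - 1) * (μ E * ((μ E)⁻¹ *
        ∫⁻ ξ in E, (ball (y : Z) (1 * 2 ^ (-n))).indicator (fun _ => (1 : ℝ≥0∞)) ξ *
          φ ξ ^ r.toReal ∂μ) ^ a) := by
    intro y
    by_cases hne : (X.vball ⟨n, y⟩ ∩ X.vball x).Nonempty
    · obtain ⟨z, hz1, hz2⟩ := hne
      have hz1' : dist z y < 2 ^ (-n) := hz1
      have hz2' : dist z (X.center x) < 2 ^ (-k) := hz2
      have hd : dist (y : Z) (X.center x) < 2 ^ (-n) + 2 ^ (-k) :=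
        (dist_triangle_left _ _ z).trans_lt (add_lt_add hz1' hz2')
      have hnk' : (2 : ℝ) ^ (-n) ≤ 2 ^ (-k) := by
        rw [hnk]; exact le_mul_of_one_le_left hn0.le hj1
      have hsub : X.vball ⟨n, y⟩ ⊆ E := ball_subset_ball' (by
        change (2 : ℝ) ^ (-n) + dist (y : Z) (X.center x) ≤ _
        linarith)
      have hdom : μ E ≤ D * ENNReal.ofReal (8 * 2 ^ j) ^ Q * μ (X.vball ⟨n, y⟩) := by
        refine h.measure_ball_le hn0 (by linarith) ?_
        change dist (X.center x) (y : Z) + _ ≤ 8 * 2 ^ j * 2 ^ (-n)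
        rw [mul_assoc, ← hnk, dist_comm]
        linarith
      have hint : ∫⁻ ξ in E, (ball (y : Z) (1 * 2 ^ (-n))).indicator (fun _ => (1 : ℝ≥0∞)) ξ *
          φ ξ ^ r.toReal ∂μ = ∫⁻ ξ in X.vball ⟨n, y⟩, φ ξ ^ r.toReal ∂μ := by
        have e1 : ball (y : Z) (1 * 2 ^ (-n)) = X.vball ⟨n, y⟩ := by rw [one_mul]; rfl
        have e2 : ∀ ξ, (X.vball ⟨n, y⟩).indicator (fun _ => (1 : ℝ≥0∞)) ξ * φ ξ ^ r.toReal =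
            (X.vball ⟨n, y⟩).indicator (fun ξ => φ ξ ^ r.toReal) ξ := fun ξ => by
          by_cases hξ : ξ ∈ X.vball ⟨n, y⟩ <;> simp [hξ]
        simp only [e1, e2]
        rw [lintegral_indicator (X.measurableSet_vball _),
          Measure.restrict_restrict (X.measurableSet_vball _), Set.inter_eq_left.2 hsub]
      rw [hint]
      refine le_trans ?_ (mul_inv_mul_rpow_le ha (X.measure_vball_ne_zero h _)
        (X.measure_vball_ne_top h _) hM0 hM hdom)
      rw [hw _ rfl, powerMean_eq hr hr', lintegral_indicator_const (X.measurableSet_vball _),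
        mul_comm]
      gcongr
      exact Measure.restrict_le_self
    · rw [lintegral_indicator_const (X.measurableSet_vball _),
        Measure.restrict_apply (X.measurableSet_vball _), Set.not_nonempty_iff_eq_empty.1 hne]
      simp
  unfold levelSum
  rw [lintegral_tsum fun y =>
    (measurable_const.indicator (X.measurableSet_vball _)).aemeasurable]
  refine (ENNReal.tsum_le_tsum hterm).trans ?_
  rw [ENNReal.tsum_mul_left, ENNReal.tsum_mul_left, mul_assoc]
  refine mul_le_mul_right ?_ _
  rw [mul_left_comm]
  refine mul_le_mul_right ?_ _
  refine (tsum_rpow_le_rpow_tsum _ ha).trans ?_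
  rw [ENNReal.tsum_mul_left, powerMean_eq hr hr', ← ENNReal.mul_rpow_of_nonneg _ _ (by linarith),
    mul_left_comm]
  gcongr ?_ ^ _
  refine mul_le_mul_right ?_ _
  exact X.tsum_setLIntegral_vball_le h n one_pos (hφ.pow_const _) E

end HyperbolicFilling

/-! ### Sobolev–Poincaré inequality and increments of the Poisson extension -/

namespace HyperbolicFilling

variable {Z : Type*} [MeasurableSpace Z] {μ : Measure Z}

/-- The sum `∑_{j ≥ 0} 2^{jτ} (⨍_E φ_{k+j}^r)^{1/r}`. -/
def meanSum (μ : Measure Z) (r : ℝ≥0∞) (τ : ℝ) (φ : ℤ → Z → ℝ≥0∞) (k : ℤ) (E : Set Z) : ℝ≥0∞ :=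
  ∑' j : ℕ, (2 : ℝ≥0∞) ^ (τ * j) * powerMean μ r (φ (k + j)) E

theorem powerMean_le_meanSum (r : ℝ≥0∞) (τ : ℝ) (φ : ℤ → Z → ℝ≥0∞) (k : ℤ) (E : Set Z) :
    powerMean μ r (φ k) E ≤ meanSum μ r τ φ k E := by
  have := ENNReal.le_tsum
    (f := fun j : ℕ => (2 : ℝ≥0∞) ^ (τ * j) * powerMean μ r (φ (k + j)) E) 0
  simpa [meanSum] using this

/-- Lowering the starting level shifts the index, and because `τ ≥ 0` the weights can only grow; the
rest is comparability of the two sets. -/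
theorem meanSum_mono {r : ℝ≥0∞} (hr : r ≠ 0) (hr' : r ≠ ∞) {τ : ℝ} (hτ : 0 ≤ τ)
    (φ : ℤ → Z → ℝ≥0∞) {k n : ℤ} (hkn : k ≤ n) {E E' : Set Z} (hEE : E ⊆ E') (hE'0 : μ E' ≠ 0)
    (hE' : μ E' ≠ ∞) {c : ℝ≥0∞} (hc : μ E' ≤ c * μ E) :
    meanSum μ r τ φ n E ≤ c ^ (1 / r.toReal) * meanSum μ r τ φ k E' := by
  obtain ⟨d, rfl⟩ := Int.le.dest hkn
  unfold meanSum
  calc _ ≤ ∑' j : ℕ, c ^ (1 / r.toReal) *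
        (fun j : ℕ => (2 : ℝ≥0∞) ^ (τ * j) * powerMean μ r (φ (k + j)) E') (j + d) := by
        refine ENNReal.tsum_le_tsum fun j => ?_
        rw [mul_left_comm]
        refine mul_le_mul' (two_rpow_mono ?_) ?_
        · push_cast
          nlinarith [mul_nonneg hτ (Nat.cast_nonneg (α := ℝ) d)]
        · have e : k + d + (j : ℤ) = k + ((j + d : ℕ) : ℤ) := by push_cast; ring
          rw [e]
          exact powerMean_mono_set hr hr' _ hEE hE'0 hE' hc
    _ ≤ _ := by
        rw [ENNReal.tsum_mul_left]
        exact mul_le_mul_right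
          (ENNReal.tsum_comp_le_tsum_of_injective (add_left_injective d) _) _

variable [MetricSpace Z] {D : ℝ≥0∞} {Q : ℝ}

/-- A Sobolev–Poincaré inequality. -/
theorem exists_setLIntegral_sub_le [BorelSpace Z] (h : HasDoublingDim μ D Q) {r : ℝ≥0∞}
    (hr : r ≠ 0) (hr1 : r ≤ 1) {s : ℝ} (hs : 0 < s) :
    ∃ C : ℝ≥0∞, C ≠ ∞ ∧ ∀ (X : HyperbolicFilling Z) (f : Z → ℂ) (g : ℤ → Z → ℝ≥0∞),
      IsHajlaszGradient μ s f g → (∀ k, ∀ᵐ ξ ∂μ, gradientTail s g k ξ ≠ ∞) →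
      ∀ ζ : X.Vertex → Z, (∀ x, ζ x ∈ X.vball x) →
      (∀ x, gradientTail s g (X.level x) (ζ x) ≤
        powerMean μ r (gradientTail s g (X.level x)) (X.vball x)) →
      ∀ x, ∫⁻ ξ in X.vball x, ‖f ξ - f (ζ x)‖ₑ ∂μ ≤ C * (μ (X.vball x) *
        meanSum μ r (Q * (1 / r.toReal - 1)) (gradientTail s g) (X.level x)
          (ball (X.center x) (4 * 2 ^ (-X.level x)))) := by
  have hr' : r ≠ ∞ := ne_top_of_le_ne_top ENNReal.one_ne_top hr1
  have h0 := ENNReal.toReal_pos hr hr'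
  set a := 1 / r.toReal with ha'
  have ha : 1 ≤ a := by
    rw [le_div_iff₀ h0, one_mul]
    exact ENNReal.toReal_le_of_le_ofReal zero_le_one (by simpa using hr1)
  have ha1 : 0 ≤ a - 1 := by linarith
  have ha0 : 0 ≤ a := by linarith
  have hD := h.const_ne_top
  have hQ := h.dim_pos.le
  have hN := h.overlapBound_ne_top 1
  refine ⟨2 * ((D * ENNReal.ofReal 8 ^ Q) ^ (a - 1) * overlapBound D Q 1 ^ a *
    (D * ENNReal.ofReal 4 ^ Q)), by finiteness, fun X f g hg hfin ζ hζ hA x => ?_⟩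
  set k := X.level x with hk
  set E := ball (X.center x) (4 * 2 ^ (-k))
  let A : X.Vertex → ℝ≥0∞ := fun x =>
    powerMean μ r (gradientTail s g (X.level x)) (X.vball x)
  have hE : μ E ≤ D * ENNReal.ofReal 4 ^ Q * μ (X.vball x) :=
    h.doubling _ _ _ (by positivity) (by norm_num)
  calc ∫⁻ ξ in X.vball x, ‖f ξ - f (ζ x)‖ₑ ∂μ
      ≤ ∫⁻ ξ in X.vball x, 2 * ∑' j : ℕ, X.levelSum A (k + j) ξ ∂μ := by
        refine lintegral_mono_ae ?_
        filter_upwards [ae_restrict_of_ae (hfin k), ae_restrict_mem (X.measurableSet_vball x)]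
          with ξ hξ hξx
        rw [← edist_eq_enorm_sub, edist_comm]
        exact X.edist_le_tsum_levelSum hs hg hζ hA hξx hξ
    _ = 2 * ∑' j : ℕ, ∫⁻ ξ in X.vball x, X.levelSum A (k + j) ξ ∂μ := by
        rw [lintegral_const_mul' _ _ (by finiteness),
          lintegral_tsum fun j => (X.measurable_levelSum h A _).aemeasurable]
    _ ≤ 2 * ∑' j : ℕ, (D * ENNReal.ofReal (8 * 2 ^ j) ^ Q) ^ (a - 1) * overlapBound D Q 1 ^ a *
          (μ E * powerMean μ r (gradientTail s g (k + j)) E) := by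
        refine mul_le_mul_right (ENNReal.tsum_le_tsum fun j => ?_) _
        refine X.setLIntegral_levelSum_powerMean_le h hr hr1
          (aemeasurable_gradientTail hg.1 (k + j)) x j A fun y hy => ?_
        simp only [A, hy, hk]
    _ = 2 * ((D * ENNReal.ofReal 8 ^ Q) ^ (a - 1) * overlapBound D Q 1 ^ a * μ E *
          meanSum μ r (Q * (a - 1)) (gradientTail s g) k E) := by
        refine congrArg (2 * ·) ?_
        unfold meanSum
        rw [← ENNReal.tsum_mul_left]
        refine tsum_congr fun j => ?_
        -- The part depending on `j` is exactly the weight in `meanSum` with `τ = Q(1/r - 1)`.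
        have e : (D * ENNReal.ofReal (8 * 2 ^ j) ^ Q) ^ (a - 1) =
            (D * ENNReal.ofReal 8 ^ Q) ^ (a - 1) * 2 ^ (Q * (a - 1) * j) := by
          rw [ENNReal.ofReal_mul (by norm_num), ENNReal.mul_rpow_of_nonneg _ _ hQ, ← mul_assoc,
            ENNReal.mul_rpow_of_nonneg _ _ ha1, ENNReal.ofReal_pow zero_le_two,
            ENNReal.ofReal_ofNat 2, ← ENNReal.rpow_natCast, ← ENNReal.rpow_mul,
            ← ENNReal.rpow_mul]
          ring_nf
        rw [e]
        ring
    _ ≤ 2 * ((D * ENNReal.ofReal 8 ^ Q) ^ (a - 1) * overlapBound D Q 1 ^ a *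
          (D * ENNReal.ofReal 4 ^ Q * μ (X.vball x)) *
          meanSum μ r (Q * (a - 1)) (gradientTail s g) k E) := by gcongr
    _ = _ := by ring

/-- Balls of vertices close to `x` are contained in, and comparable with, a multiple of `B(x)`. -/
theorem ball_subset_and_measure_le (h : HasDoublingDim μ D Q) (X : HyperbolicFilling Z)
    {x y : X.Vertex} (hxy : y = x ∨ X.graph.Adj x y) {t : ℝ} (ht : 1 ≤ t) (ht' : t ≤ 4) :
    ball (X.center y) (t * 2 ^ (-X.level y)) ⊆ ball (X.center x) (16 * 2 ^ (-X.level x)) ∧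
      μ (ball (X.center x) (16 * 2 ^ (-X.level x))) ≤
        D * ENNReal.ofReal 38 ^ Q * μ (ball (X.center y) (t * 2 ^ (-X.level y))) ∧
      X.level x - 1 ≤ X.level y := by
  have hy0 : (0 : ℝ) < 2 ^ (-X.level y) := by positivity
  have hx0 : (0 : ℝ) < 2 ^ (-X.level x) := by positivity
  have H : dist (X.center x) (X.center y) < 3 * 2 ^ (-X.level x) ∧
      (2 : ℝ) ^ (-X.level x) ≤ 2 * 2 ^ (-X.level y) ∧
      (2 : ℝ) ^ (-X.level y) ≤ 2 * 2 ^ (-X.level x) ∧ X.level x - 1 ≤ X.level y := by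
    rcases hxy with rfl | hadj
    · rw [dist_self]
      exact ⟨by positivity, by linarith, by linarith, by omega⟩
    · have h1 := X.dist_center_lt_of_adj hadj
      have h2 := X.zpow_level_le_of_adj hadj
      have h3 := X.zpow_level_le_of_adj hadj.symm
      have h4 := X.level_le_of_adj hadj.symm
      exact ⟨by linarith, h2, h3, by omega⟩
  obtain ⟨h1, h2, h3, h4⟩ := H
  refine ⟨ball_subset_ball' ?_, ?_, h4⟩
  · rw [dist_comm] at h1
    nlinarith
  -- `(3 + 16)·2^{-|x|} ≤ 38·2^{-|y|}`, as the levels differ by at most one.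
  · refine h.measure_ball_le (by positivity) (by norm_num) ?_
    nlinarith

/-- Go from `Pf(y)` to `Pf(x)` through `f(ζ_y)` and `f(ζ_x)`: the outer steps are the
Sobolev–Poincaré inequality, the middle one is adjacency. Its finite right-hand side also yields
integrability of `f`. Level `|x| - 1` and the ball `16B(x)` serve `x` and all its neighbours at
once. -/
theorem exists_enorm_poisson_sub_le [BorelSpace Z] (h : HasDoublingDim μ D Q) {r : ℝ≥0∞}
    (hr : r ≠ 0) (hr1 : r ≤ 1) {s : ℝ} (hs : 0 < s) :
    ∃ C : ℝ≥0∞, C ≠ ∞ ∧ ∀ (X : HyperbolicFilling Z) (f : Z → ℂ) (g : ℤ → Z → ℝ≥0∞),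
      AEStronglyMeasurable f μ → IsHajlaszGradient μ s f g →
      (∀ k, ∀ᵐ ξ ∂μ, gradientTail s g k ξ ≠ ∞) →
      (∀ x : X.Vertex, meanSum μ r (Q * (1 / r.toReal - 1)) (gradientTail s g) (X.level x - 1)
        (ball (X.center x) (16 * 2 ^ (-X.level x))) ≠ ∞) →
      (∀ x, IntegrableOn f (X.vball x) μ) ∧
      ∀ x y : X.Vertex, X.graph.Adj x y → ‖X.poisson μ f y - X.poisson μ f x‖ₑ ≤
        C * meanSum μ r (Q * (1 / r.toReal - 1)) (gradientTail s g) (X.level x - 1)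
          (ball (X.center x) (16 * 2 ^ (-X.level x))) := by
  have hr' : r ≠ ∞ := ne_top_of_le_ne_top ENNReal.one_ne_top hr1
  have h0 := ENNReal.toReal_pos hr hr'
  obtain ⟨C, hC, hSP⟩ := exists_setLIntegral_sub_le h hr hr1 hs
  set a := 1 / r.toReal with ha'
  have ha : 1 ≤ a := by
    rw [le_div_iff₀ h0, one_mul]
    exact ENNReal.toReal_le_of_le_ofReal zero_le_one (by simpa using hr1)
  have ha0 : 0 ≤ a := by linarith
  have hD := h.const_ne_top
  have hQ := h.dim_pos.le
  have hτ : 0 ≤ Q * (a - 1) := mul_nonneg hQ (by linarith)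
  set c := (D * ENNReal.ofReal 38 ^ Q) ^ a with hc
  have hc' : c ≠ ∞ := by finiteness
  refine ⟨2 * (C * c) + 2 * c, by finiteness, fun X f g hf hg hfin hS => ?_⟩
  choose ζ hζ hA using fun x : X.Vertex => X.exists_le_powerMean h hr hr'
    (aemeasurable_gradientTail (s := s) hg.1 (X.level x)) x
  have hSP' := hSP X f g hg hfin ζ hζ hA
  set S : X.Vertex → ℝ≥0∞ := fun x => meanSum μ r (Q * (a - 1)) (gradientTail s g)
    (X.level x - 1) (ball (X.center x) (16 * 2 ^ (-X.level x))) with hSdef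
  have hB0 : ∀ x : X.Vertex, μ (ball (X.center x) (16 * 2 ^ (-X.level x))) ≠ 0 := fun x =>
    (h.pos _ _ (by positivity)).ne'
  have hB1 : ∀ x : X.Vertex, μ (ball (X.center x) (16 * 2 ^ (-X.level x))) ≠ ∞ := fun x =>
    (h.fin _ _ (by positivity)).ne
  have hint : ∀ x y : X.Vertex, y = x ∨ X.graph.Adj x y →
      ∫⁻ ξ in X.vball y, ‖f ξ - f (ζ y)‖ₑ ∂μ ≤ C * (μ (X.vball y) * (c * S x)) := by
    intro x y hxy
    obtain ⟨e1, e2, e3⟩ := X.ball_subset_and_measure_le h hxy (t := 4) (by norm_num) le_rfl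
    refine (hSP' y).trans ?_
    gcongr
    exact meanSum_mono hr hr' hτ _ e3 e1 (hB0 x) (hB1 x) e2
  have hI : ∀ x, IntegrableOn f (X.vball x) μ := fun x => by
    have h1 : IntegrableOn (fun ξ => f ξ - f (ζ x)) (X.vball x) μ := by
      refine ⟨(hf.sub aestronglyMeasurable_const).restrict, ?_⟩
      refine (hint x x (Or.inl rfl)).trans_lt ?_
      exact ENNReal.mul_lt_top hC.lt_top (ENNReal.mul_lt_top (X.measure_vball_ne_top h x).lt_top
        (ENNReal.mul_lt_top hc'.lt_top (hS x).lt_top))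
    have h2 := h1.add (integrableOn_const (C := f (ζ x)) (X.measure_vball_ne_top h x))
    refine h2.congr (Filter.Eventually.of_forall fun ξ => ?_)
    simp
  have hAS : ∀ x y : X.Vertex, y = x ∨ X.graph.Adj x y →
      powerMean μ r (gradientTail s g (X.level y)) (X.vball y) ≤ c * S x := by
    intro x y hxy
    obtain ⟨e1, e2, e3⟩ := X.ball_subset_and_measure_le h hxy (t := 1) le_rfl (by norm_num)
    rw [one_mul] at e1 e2
    exact (powerMean_le_meanSum r (Q * (a - 1)) _ _ _).trans
      (meanSum_mono hr hr' hτ _ e3 e1 (hB0 x) (hB1 x) e2)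
  have hu : ∀ x y : X.Vertex, y = x ∨ X.graph.Adj x y →
      edist (X.poisson μ f y) (f (ζ y)) ≤ C * (c * S x) := by
    intro x y hxy
    rw [edist_eq_enorm_sub]
    refine (enorm_setAverage_sub_le (X.measure_vball_ne_zero h y) (X.measure_vball_ne_top h y)
      (hI y) _).trans ?_
    calc _ ≤ (μ (X.vball y))⁻¹ * (C * (μ (X.vball y) * (c * S x))) := by
          gcongr
          exact hint x y hxy
      _ = ((μ (X.vball y))⁻¹ * μ (X.vball y)) * (C * (c * S x)) := by ring
      _ = _ := by rw [ENNReal.inv_mul_cancel (X.measure_vball_ne_zero h y)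
                    (X.measure_vball_ne_top h y), one_mul]
  refine ⟨hI, fun x y hxy => ?_⟩
  rw [← edist_eq_enorm_sub]
  have t1 := edist_triangle4 (X.poisson μ f y) (f (ζ y)) (f (ζ x)) (X.poisson μ f x)
  have t2 := X.edist_le_of_adj hs hg hζ hA hxy
  rw [edist_comm (f (ζ x)) (X.poisson μ f x), edist_comm (f (ζ y))] at t1
  refine t1.trans ((add_le_add (add_le_add (hu x y (Or.inr hxy))
    (t2.trans (add_le_add (hAS x x (Or.inl rfl)) (hAS x y (Or.inr hxy)))))
    (hu x x (Or.inl rfl))).trans (le_of_eq ?_))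
  change _ = (2 * (C * c) + 2 * c) * S x
  ring

end HyperbolicFilling

/-! ### The Besov norm is bounded by any gradient -/

namespace HyperbolicFilling

section

variable {Z : Type*} [MeasurableSpace Z]

/-- The gain `2^{-sj}` of the tail at level `k - 1 + j` beats the loss `2^{τj}`; the double sum then
collapses by `geom_tsum_tsum_le`. The index `k - 4` combines the level `k - 1` with the margin `3`
of the tail. -/
theorem exists_meanSum_gradientTail_le {r : ℝ≥0∞} (hr : r ≠ 0) {s τ ε : ℝ} (hs : 0 < s)
    (hε : 0 < ε) (hετ : 2 * ε ≤ s - τ) (hεs : ε ≤ s / 4) :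
    ∃ C : ℝ≥0∞, C ≠ ∞ ∧ ∀ (μ : Measure Z) (g : ℤ → Z → ℝ≥0∞), (∀ k, AEMeasurable (g k) μ) →
      ∀ (k : ℤ) (E : Set Z),
        (2 : ℝ≥0∞) ^ ((k : ℝ) * s) * meanSum μ r τ (gradientTail s g) (k - 1) E ≤
          C * ∑' m : ℕ, (2 : ℝ≥0∞) ^ (-(ε * m)) * powerMean μ r (g (k - 4 + m)) E := by
  obtain ⟨C, hC, h⟩ := exists_powerMean_gradientTail_le (Z := Z) hr hs
  have h4 := two_rpow_ne_top (4 * s)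
  have hg := geomSum_ne_top hε
  refine ⟨2 ^ (4 * s) * C * geomSum ε, by finiteness, fun μ g hgm k E => ?_⟩
  unfold meanSum
  calc _ ≤ 2 ^ (4 * s) * C * ∑' j : ℕ, (2 : ℝ≥0∞) ^ (-((s - τ) * j)) *
        ∑' i : ℕ, (2 : ℝ≥0∞) ^ (-(s / 4 * i)) *
          (fun m : ℕ => powerMean μ r (g (k - 4 + m)) E) (j + i) := by
        rw [← ENNReal.tsum_mul_left, ← ENNReal.tsum_mul_left]
        refine ENNReal.tsum_le_tsum fun j => ?_
        have e1 : ∀ i : ℕ, k - 1 + (j : ℤ) - 3 + (i : ℤ) = k - 4 + ((j + i : ℕ) : ℤ) := fun i => by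
          push_cast; ring
        have h1 := h μ g hgm (k - 1 + j) E
        simp only [e1] at h1
        refine (mul_le_mul_right (mul_le_mul_right h1 _) _).trans (le_of_eq ?_)
        have e2 : (2 : ℝ≥0∞) ^ ((k : ℝ) * s) * (2 ^ (τ * j) *
            2 ^ (-(s * (((k - 1 + j : ℤ) : ℝ) - 3)))) = 2 ^ (4 * s) * 2 ^ (-((s - τ) * j)) := by
          rw [← two_rpow_add, ← two_rpow_add, ← two_rpow_add]
          push_cast
          ring_nf
        calc _ = ((2 : ℝ≥0∞) ^ ((k : ℝ) * s) * (2 ^ (τ * j) *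
            2 ^ (-(s * (((k - 1 + j : ℤ) : ℝ) - 3))))) * (C * ∑' i : ℕ,
              (2 : ℝ≥0∞) ^ (-(s / 4 * i)) * powerMean μ r (g (k - 4 + ((j + i : ℕ) : ℤ))) E) := by
              ring
          _ = _ := by rw [e2]; ring
    _ ≤ _ := by
        rw [mul_assoc _ (geomSum ε)]
        exact mul_le_mul_right (geom_tsum_tsum_le hετ hεs _) _

end

variable {Z : Type*} [MetricSpace Z]

theorem levelSum_eq (X : HyperbolicFilling Z) (w : X.Vertex → ℝ≥0∞) (n : ℤ) (ξ : Z) :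
    X.levelSum w n ξ =
      ∑' x : X.net n, (X.vball ⟨n, x⟩).indicator (fun _ => (1 : ℝ≥0∞)) ξ * w ⟨n, x⟩ := by
  refine tsum_congr fun x => ?_
  by_cases hξ : ξ ∈ X.vball ⟨n, x⟩ <;> simp [hξ]

theorem levelSum_mono (X : HyperbolicFilling Z) {w v : X.Vertex → ℝ≥0∞} {n : ℤ}
    (h : ∀ x, X.level x = n → w x ≤ v x) (ξ : Z) : X.levelSum w n ξ ≤ X.levelSum v n ξ := by
  rw [levelSum_eq, levelSum_eq]
  exact ENNReal.tsum_le_tsum fun x => mul_le_mul_right (h _ rfl) _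

theorem levelSum_const_mul (X : HyperbolicFilling Z) (c : ℝ≥0∞) (w : X.Vertex → ℝ≥0∞) (n : ℤ)
    (ξ : Z) : X.levelSum (fun x => c * w x) n ξ = c * X.levelSum w n ξ := by
  rw [levelSum_eq, levelSum_eq, ← ENNReal.tsum_mul_left]
  exact tsum_congr fun x => mul_left_comm _ _ _

theorem levelSum_tsum (X : HyperbolicFilling Z) (w : ℕ → X.Vertex → ℝ≥0∞) (n : ℤ) (ξ : Z) :
    X.levelSum (fun x => ∑' m, w m x) n ξ = ∑' m, X.levelSum (w m) n ξ := by
  simp only [levelSum_eq, ← ENNReal.tsum_mul_left]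
  exact ENNReal.tsum_comm

/-- Used to pass from integrability on the balls `B(x)` to integrability on all bounded sets. -/
theorem exists_subset_vball (X : HyperbolicFilling Z) {A : Set Z} (hA : Bornology.IsBounded A)
    (hne : A.Nonempty) : ∃ x : X.Vertex, A ⊆ X.vball x := by
  obtain ⟨ξ, -⟩ := hne
  obtain ⟨R, hR⟩ := hA.subset_ball ξ
  obtain ⟨n, hn⟩ := pow_unbounded_of_one_lt (2 * R) (one_lt_two (α := ℝ))
  obtain ⟨y, hy, hd⟩ := X.exists_mem_net (-(n : ℤ)) ξ
  refine ⟨⟨-(n : ℤ), y, hy⟩, fun z hz => ?_⟩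
  have hz' : dist z ξ < R := hR hz
  change dist z y < 2 ^ (-(-(n : ℤ)))
  have e : (2 : ℝ) ^ (-(-(n : ℤ))) = 2 ^ n := by rw [neg_neg, zpow_natCast]
  rw [e] at hd ⊢
  have := dist_triangle z ξ y
  linarith

variable [MeasurableSpace Z] {μ : Measure Z} {D : ℝ≥0∞} {Q : ℝ}

theorem tsum_indicator_vball_le [BorelSpace Z] (h : HasDoublingDim μ D Q)
    (X : HyperbolicFilling Z) (n : ℤ) (ξ : Z) :
    ∑' y : X.net n, (X.vball ⟨n, y⟩).indicator (fun _ => (1 : ℝ≥0∞)) ξ ≤ overlapBound D Q 1 := by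
  have := X.tsum_indicator_ball_le h n one_pos ξ
  simp only [one_mul] at this
  exact this

/-- The operator `φ ↦ ∑_{x ∈ X_k} (⨍_{16B(x)} φ^p)^{1/p} χ_{B(x)}` is bounded on `L^p`. -/
theorem exists_eLpNorm_levelSum_powerMean_le [BorelSpace Z] (h : HasDoublingDim μ D Q)
    {p : ℝ≥0∞} (hp : p ≠ 0) :
    ∃ C : ℝ≥0∞, C ≠ ∞ ∧ ∀ (X : HyperbolicFilling Z) (φ : Z → ℝ≥0∞), AEMeasurable φ μ → ∀ k : ℤ,
      eLpNorm (X.levelSum (fun x => powerMean μ p φ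
        (ball (X.center x) (16 * 2 ^ (-X.level x)))) k) p μ ≤ C * eLpNorm φ p μ := by
  have hN := h.overlapBound_ne_top 1
  have hN' := h.overlapBound_ne_top 16
  have hE : ∀ (X : HyperbolicFilling Z) (x : X.Vertex),
      μ (ball (X.center x) (16 * 2 ^ (-X.level x))) ≠ ∞ := fun X x =>
    (h.fin _ _ (by positivity)).ne
  by_cases hp' : p = ∞
  · subst hp'
    refine ⟨overlapBound D Q 1, hN, fun X φ hφ k => ?_⟩
    rw [eLpNorm_exponent_top]
    simp only [eLpNormEssSup, enorm_eq_self]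
    refine essSup_le_of_ae_le _ (Filter.Eventually.of_forall fun ξ => ?_)
    refine (X.levelSum_mono (v := fun _ => eLpNorm φ ∞ μ) (fun x _ => ?_) ξ).trans ?_
    · simpa using powerMean_le_mul_eLpNorm (p := ∞) (φ := φ) (hE X x)
    · rw [levelSum_eq, ENNReal.tsum_mul_right]
      exact mul_le_mul_left (X.tsum_indicator_vball_le h k ξ) _
  · have h0 := ENNReal.toReal_pos hp hp'
    set t := p.toReal with ht
    have ht1 : 0 ≤ 1 / t := by positivity
    refine ⟨(overlapBound D Q 1 ^ t * overlapBound D Q 16) ^ (1 / t), by finiteness,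
      fun X φ hφ k => ?_⟩
    have := X.countable_net h k
    rw [eLpNorm_ennreal_eq hp hp', eLpNorm_ennreal_eq hp hp', ← ht,
      ← ENNReal.mul_rpow_of_nonneg _ _ ht1]
    refine ENNReal.rpow_le_rpow ?_ ht1
    set w : X.Vertex → ℝ≥0∞ := fun x => powerMean μ p φ
      (ball (X.center x) (16 * 2 ^ (-X.level x))) with hw
    -- The indicators act as weights in `rpow_tsum_mul_le`; their sum is the overlap, so the power
    -- passes inside the sum for every `t > 0`.
    have h1 : ∀ ξ, X.levelSum w k ξ ^ t ≤ overlapBound D Q 1 ^ t *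
        ∑' x : X.net k, (X.vball ⟨k, x⟩).indicator (fun _ => w ⟨k, x⟩ ^ t) ξ := fun ξ => by
      have e1 : X.levelSum w k ξ = ∑' x : X.net k,
          (X.vball ⟨k, x⟩).indicator (fun _ => (1 : ℝ≥0∞)) ξ *
            (X.vball ⟨k, x⟩).indicator (fun _ => w ⟨k, x⟩) ξ := by
        refine tsum_congr fun x => ?_
        by_cases hξ : ξ ∈ X.vball ⟨k, x⟩ <;> simp [hξ]
      have e2 : ∀ x : X.net k, (X.vball ⟨k, x⟩).indicator (fun _ => w ⟨k, x⟩) ξ ^ t =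
          (X.vball ⟨k, x⟩).indicator (fun _ => w ⟨k, x⟩ ^ t) ξ := fun x => by
        by_cases hξ : ξ ∈ X.vball ⟨k, x⟩ <;> simp [hξ, h0]
      rw [e1]
      refine (rpow_tsum_mul_le _ _ h0).trans ?_
      simp only [e2]
      gcongr
      exact X.tsum_indicator_vball_le h k ξ
    have h2 : ∀ x : X.net k, ∫⁻ ξ, (X.vball ⟨k, x⟩).indicator (fun _ => w ⟨k, x⟩ ^ t) ξ ∂μ ≤
        ∫⁻ ξ in Set.univ, (ball (x : Z) (16 * 2 ^ (-k))).indicator (fun _ => (1 : ℝ≥0∞)) ξ *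
          φ ξ ^ t ∂μ := fun x => by
      have e2 : ∀ ξ, (ball (x : Z) (16 * 2 ^ (-k))).indicator (fun _ => (1 : ℝ≥0∞)) ξ * φ ξ ^ t =
          (ball (x : Z) (16 * 2 ^ (-k))).indicator (fun ξ => φ ξ ^ t) ξ := fun ξ => by
        by_cases hξ : ξ ∈ ball (x : Z) (16 * 2 ^ (-k))
        · rw [Set.indicator_of_mem hξ, Set.indicator_of_mem hξ, one_mul]
        · rw [Set.indicator_of_notMem hξ, Set.indicator_of_notMem hξ, zero_mul]
      simp only [e2]
      rw [Measure.restrict_univ, lintegral_indicator measurableSet_ball,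
        lintegral_indicator_const (X.measurableSet_vball _), hw]
      simp only
      rw [powerMean_eq hp hp', ← ENNReal.rpow_mul, ← ht, one_div_mul_cancel h0.ne',
        ENNReal.rpow_one]
      have hB0 : μ (ball (x : Z) (16 * 2 ^ (-k))) ≠ 0 := (h.pos _ _ (by positivity)).ne'
      have hB1 : μ (ball (x : Z) (16 * 2 ^ (-k))) ≠ ∞ := (h.fin _ _ (by positivity)).ne
      have hsub : X.vball ⟨k, x⟩ ⊆ ball (x : Z) (16 * 2 ^ (-k)) := ball_subset_ball (by
        have : (0 : ℝ) < 2 ^ (-k) := by positivity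
        change (2 : ℝ) ^ (-k) ≤ _
        linarith)
      change (μ (ball (x : Z) (16 * 2 ^ (-k))))⁻¹ * (∫⁻ ξ in ball (x : Z) (16 * 2 ^ (-k)),
        φ ξ ^ t ∂μ) * μ (X.vball ⟨k, x⟩) ≤ _
      calc _ ≤ (μ (ball (x : Z) (16 * 2 ^ (-k))))⁻¹ * (∫⁻ ξ in ball (x : Z) (16 * 2 ^ (-k)),
            φ ξ ^ t ∂μ) * μ (ball (x : Z) (16 * 2 ^ (-k))) := by gcongr
        _ = _ := by
            rw [mul_right_comm, ENNReal.inv_mul_cancel hB0 hB1, one_mul]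
    calc ∫⁻ ξ, X.levelSum w k ξ ^ t ∂μ
        ≤ ∫⁻ ξ, overlapBound D Q 1 ^ t *
          ∑' x : X.net k, (X.vball ⟨k, x⟩).indicator (fun _ => w ⟨k, x⟩ ^ t) ξ ∂μ :=
          lintegral_mono h1
      _ = overlapBound D Q 1 ^ t * ∑' x : X.net k,
          ∫⁻ ξ, (X.vball ⟨k, x⟩).indicator (fun _ => w ⟨k, x⟩ ^ t) ξ ∂μ := by
          rw [lintegral_const_mul' _ _ (by finiteness), lintegral_tsum fun x =>
            (measurable_const.indicator (X.measurableSet_vball _)).aemeasurable]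
      _ ≤ overlapBound D Q 1 ^ t * (overlapBound D Q 16 * ∫⁻ ξ in Set.univ, φ ξ ^ t ∂μ) := by
          refine mul_le_mul_right ((ENNReal.tsum_le_tsum h2).trans ?_) _
          exact X.tsum_setLIntegral_vball_le h k (by norm_num) (hφ.pow_const _) _
      _ = _ := by rw [Measure.restrict_univ, mul_assoc]

/-- With `r = min(p, 1)` the conclusion is a rewriting of `r > Q/(Q+s)`, which holds because
`Q/(Q+s)` is less than both `p` and 1. -/
theorem exists_exponent {s : ℝ} (hQ : 0 < Q) (hs : 0 < s) {p : ℝ≥0∞}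
    (hp : ENNReal.ofReal (Q / (Q + s)) < p) :
    ∃ r : ℝ≥0∞, r ≠ 0 ∧ r ≤ 1 ∧ r ≤ p ∧ Q * (1 / r.toReal - 1) < s := by
  refine ⟨min p 1, ?_, min_le_right _ _, min_le_left _ _, ?_⟩
  · exact (lt_min (zero_le.trans_lt hp) one_pos).ne'
  · have h1 : ENNReal.ofReal (Q / (Q + s)) < min p 1 := by
      refine lt_min hp ?_
      rw [ENNReal.ofReal_lt_one, div_lt_one (by positivity)]
      linarith
    rw [ENNReal.ofReal_lt_iff_lt_toReal (by positivity)
      (ne_top_of_le_ne_top ENNReal.one_ne_top (min_le_right _ _)),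
      div_lt_iff₀ (by positivity)] at h1
    have h2 : 0 < (min p 1).toReal := by
      by_contra hcon
      nlinarith
    rw [← sub_pos]
    have e : s - Q * (1 / (min p 1).toReal - 1) =
        ((min p 1).toReal * (Q + s) - Q) / (min p 1).toReal := by
      field_simp
      ring
    rw [e]
    exact div_pos (by linarith) h2

theorem exists_besovNorm_le [BorelSpace Z] (h : HasDoublingDim μ D Q) {s : ℝ} (hs : 0 < s)
    {p q : ℝ≥0∞} (hp : ENNReal.ofReal (Q / (Q + s)) < p) (hq : 0 < q) :
    ∃ C : ℝ≥0∞, C ≠ ∞ ∧ ∀ (X : HyperbolicFilling Z) (f : Z → ℂ) (g : ℤ → Z → ℝ≥0∞),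
      AEStronglyMeasurable f μ → IsHajlaszGradient μ s f g →
      (lqNorm q fun k => eLpNorm (g k) p μ) ≠ ∞ →
      IsLocL1 μ f ∧ X.besovNorm μ s p q f ≤ C * lqNorm q fun k => eLpNorm (g k) p μ := by
  obtain ⟨r, hr, hr1, hrp, hτ⟩ := exists_exponent h.dim_pos hs hp
  have hp0 : p ≠ 0 := (zero_le.trans_lt hp).ne'
  set τ := Q * (1 / r.toReal - 1) with hτ'
  set ε := min ((s - τ) / 2) (s / 4) with hε'
  have hε : 0 < ε := lt_min (by linarith) (by linarith)
  have hε1 : 2 * ε ≤ s - τ := by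
    have := min_le_left ((s - τ) / 2) (s / 4)
    linarith
  obtain ⟨C₁, hC₁, h₁⟩ := exists_enorm_poisson_sub_le h hr hr1 hs
  obtain ⟨C₂, hC₂, h₂⟩ := exists_meanSum_gradientTail_le (Z := Z) (τ := τ) hr hs hε hε1
    (min_le_right _ _)
  obtain ⟨C₃, hC₃, h₃⟩ := exists_eLpNorm_levelSum_powerMean_le h hp0
  obtain ⟨C₄, hC₄, h₄⟩ := exists_eLpNorm_geom_tsum_le (α := Z) hp0 hε
  obtain ⟨C₅, hC₅, h₅⟩ := exists_lqNorm_geom_tsum_le hq (ε := ε / 4) (by positivity)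
  set c := (3 * overlapBound D Q 3) ^ (1 / 2 : ℝ) with hc
  have hc' : c ≠ ∞ := by
    have := h.overlapBound_ne_top 3
    finiteness
  refine ⟨c * C₁ * C₂ * C₄ * C₃ * C₅, by finiteness, fun X f g hf hg hfin => ?_⟩
  have hE0 : ∀ x : X.Vertex, μ (ball (X.center x) (16 * 2 ^ (-X.level x))) ≠ 0 := fun x =>
    (h.pos _ _ (by positivity)).ne'
  have hE1 : ∀ x : X.Vertex, μ (ball (X.center x) (16 * 2 ^ (-X.level x))) ≠ ∞ := fun x =>
    (h.fin _ _ (by positivity)).ne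
  set P : ℤ → X.Vertex → ℝ≥0∞ := fun n x =>
    powerMean μ p (g n) (ball (X.center x) (16 * 2 ^ (-X.level x))) with hP
  have hS : ∀ x : X.Vertex, (2 : ℝ≥0∞) ^ ((X.level x : ℝ) * s) *
      meanSum μ r τ (gradientTail s g) (X.level x - 1)
        (ball (X.center x) (16 * 2 ^ (-X.level x))) ≤
      C₂ * ∑' m : ℕ, (2 : ℝ≥0∞) ^ (-(ε * m)) * P (X.level x - 4 + m) x := fun x => by
    refine (h₂ μ g hg.1 (X.level x) _).trans ?_
    gcongr
    exact powerMean_le_powerMean hrp (hg.1 _) (hE0 x) (hE1 x)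
  -- Qualitative only: the bound involves a negative power of the measure of the ball, but it
  -- licenses the integrability of `f`.
  have hSfin : ∀ x : X.Vertex, meanSum μ r τ (gradientTail s g) (X.level x - 1)
      (ball (X.center x) (16 * 2 ^ (-X.level x))) ≠ ∞ := fun x e => by
    have h6 := hS x
    rw [e, ENNReal.mul_top (two_rpow_ne_zero _), top_le_iff] at h6
    revert h6
    refine ENNReal.mul_ne_top hC₂ (ne_top_of_le_ne_top ?_ (ENNReal.tsum_le_tsum fun m =>
      mul_le_mul_right ((powerMean_le_mul_eLpNorm (hE1 x)).trans
        (mul_le_mul_right (le_lqNorm hq (fun k => eLpNorm (g k) p μ) _) _)) _))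
    rw [ENNReal.tsum_mul_right]
    refine ENNReal.mul_ne_top (geomSum_ne_top hε) (ENNReal.mul_ne_top ?_ hfin)
    exact ENNReal.rpow_ne_top_of_nonneg ENNReal.toReal_nonneg (ENNReal.inv_ne_top.2 (hE0 x))
  obtain ⟨hI, hadj⟩ := h₁ X f g hf hg (ae_gradientTail_ne_top hp0 hq hs hg.1 hfin) hSfin
  refine ⟨⟨hf, fun A hA => ?_⟩, ?_⟩
  · rcases A.eq_empty_or_nonempty with rfl | hne
    · exact integrableOn_empty
    · obtain ⟨x, hx⟩ := X.exists_subset_vball hA hne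
      exact (hI x).mono_set hx
  have hdl : ∀ x : X.Vertex, (2 : ℝ≥0∞) ^ ((X.level x : ℝ) * s) *
      X.derivLength (X.poisson μ f) x ≤
        c * C₁ * C₂ * ∑' m : ℕ, (2 : ℝ≥0∞) ^ (-(ε * m)) * P (X.level x - 4 + m) x := fun x => by
    have h6 := X.derivLength_le h (X.poisson μ f) x (hadj x)
    calc _ ≤ (2 : ℝ≥0∞) ^ ((X.level x : ℝ) * s) * (c * (C₁ * meanSum μ r τ (gradientTail s g)
          (X.level x - 1) (ball (X.center x) (16 * 2 ^ (-X.level x))))) := mul_le_mul_right h6 _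
      _ = c * C₁ * ((2 : ℝ≥0∞) ^ ((X.level x : ℝ) * s) * meanSum μ r τ (gradientTail s g)
          (X.level x - 1) (ball (X.center x) (16 * 2 ^ (-X.level x)))) := by ring
      _ ≤ c * C₁ * (C₂ * ∑' m : ℕ, (2 : ℝ≥0∞) ^ (-(ε * m)) * P (X.level x - 4 + m) x) :=
          mul_le_mul_right (hS x) _
      _ = _ := by ring
  rw [besovNorm_eq]
  have hk : ∀ k : ℤ, (2 : ℝ≥0∞) ^ ((k : ℝ) * s) *
      eLpNorm (X.levelSum (X.derivLength (X.poisson μ f)) k) p μ ≤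
      c * C₁ * C₂ * C₄ * C₃ * ∑' m : ℕ, (2 : ℝ≥0∞) ^ (-(ε / 4 * m)) *
        eLpNorm (g (k + (-4) + m)) p μ := fun k => by
    have h7 : ∀ ξ, 2 ^ ((k : ℝ) * s) * X.levelSum (X.derivLength (X.poisson μ f)) k ξ ≤
        c * C₁ * C₂ * ∑' m : ℕ, (2 : ℝ≥0∞) ^ (-(ε * m)) * X.levelSum (P (k + (-4) + m)) k ξ :=
      fun ξ => by
        rw [← levelSum_const_mul]
        refine (X.levelSum_mono (v := fun x => c * C₁ * C₂ * ∑' m : ℕ,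
          (2 : ℝ≥0∞) ^ (-(ε * m)) * P (k + (-4) + m) x) (fun x hx => ?_) ξ).trans (le_of_eq ?_)
        · have := hdl x
          rwa [hx] at this
        · rw [levelSum_const_mul, levelSum_tsum]
          simp only [levelSum_const_mul]
    rw [← eLpNorm_ennreal_mul_le hp0 (two_rpow_ne_top _)]
    refine (eLpNorm_ennreal_mono_ae (Filter.Eventually.of_forall h7)).trans ?_
    rw [eLpNorm_ennreal_mul_le hp0 (by finiteness)]
    refine (mul_le_mul_right (h₄ μ _ fun m =>
      (X.measurable_levelSum h (P (k + (-4) + m)) k).aemeasurable) _).trans ?_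
    rw [mul_assoc (c * C₁ * C₂ * C₄), mul_assoc (c * C₁ * C₂)]
    refine mul_le_mul_right (mul_le_mul_right ?_ _) _
    rw [← ENNReal.tsum_mul_left (a := C₃)]
    refine ENNReal.tsum_le_tsum fun m => ?_
    rw [mul_left_comm]
    exact mul_le_mul_right (h₃ X _ (hg.1 _) k) _
  refine (lqNorm_mono hk).trans ?_
  rw [lqNorm_const_mul hq, mul_assoc _ C₅]
  exact mul_le_mul_right (h₅ (-4) fun k => eLpNorm (g k) p μ) _

end HyperbolicFilling

end

/-! ### Equivalence of the two spaces -/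

theorem mainTheorem2 {Z : Type*} [MetricSpace Z] [MeasurableSpace Z] [BorelSpace Z]
    (μ : Measure Z)
    (hpos : ∀ (ξ : Z) (r : ℝ), 0 < r → 0 < μ (ball ξ r))
    (hfin : ∀ (ξ : Z) (r : ℝ), 0 < r → μ (ball ξ r) < ∞)
    (K Q : ℝ) (hQ : 0 < Q)
    (hdoubling : ∀ (ξ : Z) (r t : ℝ), 0 < r → 1 ≤ t →
      μ (ball ξ (t * r)) ≤ ENNReal.ofReal (K * t ^ Q) * μ (ball ξ r))
    (s : ℝ) (hs0 : 0 < s) (hs1 : s ≤ 1)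
    (p q : ℝ≥0∞) (hp : ENNReal.ofReal (Q / (Q + s)) < p) (hq : 0 < q) :
    ∃ C : ℝ≥0, ∀ X : HyperbolicFilling Z,
      besovSpace X μ s p q = hajlaszSpace μ s p q ∧
      ∀ f ∈ besovSpace X μ s p q,
        hajlaszNorm μ s p q f ≤ C * X.besovNorm μ s p q f ∧
        X.besovNorm μ s p q f ≤ C * hajlaszNorm μ s p q f := by
  have h : HasDoublingDim μ (ENNReal.ofReal K) Q := by
    refine ⟨hpos, hfin, ENNReal.ofReal_ne_top, hQ, fun ξ r t hr ht => ?_⟩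
    have ht0 : 0 < t := by linarith
    rw [ENNReal.ofReal_rpow_of_pos ht0, ← ENNReal.ofReal_mul' (by positivity)]
    exact hdoubling ξ r t hr ht
  obtain ⟨C₁, hC₁, h₁⟩ :=
    HyperbolicFilling.exists_hajlaszNorm_le h hs0 (zero_le.trans_lt hp).ne' hq
  obtain ⟨C₂, hC₂, h₂⟩ := HyperbolicFilling.exists_besovNorm_le h hs0 hp hq
  have hloc : ∀ (X : HyperbolicFilling Z) (f : Z → ℂ), f ∈ hajlaszSpace μ s p q →
      IsLocL1 μ f := by
    rintro X f ⟨hf, hfin⟩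
    simp only [hajlaszNorm, iInf_lt_iff] at hfin
    obtain ⟨g, hg, hlt⟩ := hfin
    exact (h₂ X f g hf hg hlt.ne).1
  have hle : ∀ (X : HyperbolicFilling Z) (f : Z → ℂ), AEStronglyMeasurable f μ →
      X.besovNorm μ s p q f ≤ (C₂ + 1) * hajlaszNorm μ s p q f := by
    intro X f hf
    -- Adding 1 makes the constant nonzero, so that one may divide by it to pass to the infimum, and
    -- so that gradients of infinite norm satisfy the bound trivially.
    have h0 : C₂ + 1 ≠ 0 := by simp
    have h1 : C₂ + 1 ≠ ∞ := by finiteness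
    rw [← ENNReal.div_le_iff' h0 h1]
    refine le_iInf₂ fun g hg => ?_
    rw [ENNReal.div_le_iff' h0 h1]
    by_cases hlt : (lqNorm q fun k => eLpNorm (g k) p μ) = ∞
    · rw [hlt, ENNReal.mul_top h0]
      exact le_top
    · exact ((h₂ X f g hf hg hlt).2).trans (mul_le_mul_left (le_add_of_nonneg_right zero_le) _)
  refine ⟨(C₁ + (C₂ + 1)).toNNReal, fun X => ⟨Set.ext fun f => ⟨fun hf => ?_, fun hf => ?_⟩,
    fun f hf => ?_⟩⟩
  · exact ⟨hf.1.1, (h₁ X f hf.1).trans_lt (ENNReal.mul_lt_top hC₁.lt_top hf.2)⟩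
  · exact ⟨hloc X f hf, (hle X f hf.1).trans_lt (ENNReal.mul_lt_top (by finiteness) hf.2)⟩
  · rw [ENNReal.coe_toNNReal (by finiteness)]
    exact ⟨(h₁ X f hf.1).trans (mul_le_mul_left (le_add_of_nonneg_right zero_le) _),
      (hle X f hf.1.1).trans (mul_le_mul_left (le_add_of_nonneg_left zero_le) _)⟩
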